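/- **Setting.** Let $K\subset S^3$ be a tame knot with a fixed tubular neighbourhood $S^1\times D^2\hookrightarrow S^3$; a *meridian* is an element $\mathfrak m\in\pi=\pi_1(S^3\setminus K,b)$ of the form $[\gamma\cdot\partial D^2\cdot\gamma^{-1}]$ for a fibre disc $D^2$ with its given orientation and a path $\gamma$ from $b$ to $\partial D^2$. Fix a Seifert surface $F$ of genus $g$ of $K$ with a bicollar, a regular spine $W=u_1\vee\dots\vee u_{2g}\subset F$ (a bouquet of circles that is a deformation retract of $F$ and is isotopic in $S^3$ to the standard planar bouquet), a base point in $S^3\setminus F$ with paths in $S^3\setminus F$ to the two push-offs of the wedge point, and free generators $x_1,\dots,x_{2g}$ of $\pi_1(S^3\setminus F)$. The push-offs $u_j^\flat,u_j^\sharp$ of $u_j$ to the lower and the upper side of $F$ are words $y_j,z_j$ in $x_1,\dots,x_{2g}$, and the loop which crosses $F$ once at the wedge point is required to be a meridian $\mathfrak m$; this gives $\pi=\langle x_1,\dots,x_{2g},\mathfrak m\mid \mathfrak m y_j\mathfrak m^{-1}=z_j\rangle$. Transporting $\mathfrak m$ and the $x_i$ to the base point $b$ along a path $h$ (a *frame*)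 replaces $(\mathfrak m,x_i)$ by simultaneous conjugates and does not change the words $y_j,z_j$. Let $\mathcal A$ be a ring, $\kappa$ an automorphism of $\mathcal A$, and $\mathcal A_\kappa((\tau))$ the ring of series $\sum_{n\ge -n_0}a_n\tau^n$ with $\tau a=\kappa(a)\tau$. Put $\mathcal Q_{\mathcal A,\kappa}=K_1(\mathcal A_\kappa((\tau)))/\mathrm{im}\,K_1(\mathcal A)$. For a ring homomorphism $\rho:\mathbb Z[\pi]\to\mathcal A_\kappa((\tau))$ with $(\dagger)$: $\rho(\mathfrak m)=\tau$ and $\rho(x_i)\in\mathcal A$, let $A_{F,W}=\bigl(\tau\rho(\partial y_j/\partial x_i)-\rho(\partial z_j/\partial x_i)\bigr)_{j,i}$ (Fox derivatives; $j$ indexes rows and $i$ columns), and let $\Delta^{K_1}_\rho\in\mathcal Q_{\mathcal A,\kappa}\cup\{0\}$ be the class of $[\tau]^{-g}[A_{F,W}]$ if $A_{F,W}$ is invertible, and $0$ otherwise. If $\mathfrak m'$ is another meridian, then $\rho(\mathfrak m')=c\tau$ with $c\in\mathcal A^\times$, and choosing $\mathfrak m'$ instead of $\mathfrak m$ replaces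 $(\kappa,\rho)$ by $(\kappa',\rho')$, where $\kappa'(a)=c\,\kappa(a)\,c^{-1}$ and $\rho':\mathbb Z[\pi]\to\mathcal A_{\kappa'}((\tau'))$ rewrites the values of $\rho$ in terms of $\tau'=\rho(\mathfrak m')$: if $\rho'(\gamma)=\sum a_n\tau'^n$, then $\rho(\gamma)=\sum a_n\rho(\mathfrak m')^n$. If $\kappa^N=\mathrm{id}$ with $N\geq 1$, let $\Upsilon:\mathcal A_\kappa((\tau))\to \mathrm{Mat}(N\times N,\mathcal A_{\mathrm{id}}((t)))$ be the ring homomorphism that sends $a\in\mathcal A$ to $\mathrm{diag}(\kappa^N(a),\dots,\kappa^2(a),\kappa(a))$ and $\tau$ to $t$ times the cyclic permutation matrix with ones just below the diagonal and in the upper right corner (and $\sum a_n\tau^n$ to $\sum\Upsilon(a_n)\Upsilon(\tau)^n$). Let $\mathcal M$ be the Morita isomorphism $K_1(\mathrm{Mat}(N\times N,\mathcal A_{\mathrm{id}}((t))))\cong K_1(\mathcal A_{\mathrm{id}}((t)))$. The composite $\mathcal M\circ\Upsilon_*$ descends to $\mathcal Q_{\mathcal A,\kappa}\to\mathcal Q_{\mathcal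 A,\mathrm{id}}$, and is extended by $0\mapsto 0$. **Proposition.** 0. The frames yield exactly the meridians: $m\in\pi$ is a meridian if and only if it is the meridian of some frame. 1. Suppose $\kappa^N=\mathrm{id}$, $N\ge 1$, and let $\rho$ satisfy $(\dagger)$ for a frame with meridian $\mathfrak m$. For every frame with meridian $\mathfrak m'$, and for $(\kappa',\rho')$ obtained from $(\kappa,\rho)$ by choosing $\mathfrak m'$, one has $\kappa'^N=\mathrm{id}$ and $$\mathcal M\circ\Upsilon_*(\Delta_\rho^{K_1})=\mathcal M\circ\Upsilon'_*(\Delta_{\rho'}^{K_1})\in\mathcal Q_{\mathcal A,\mathrm{id}}\cup\{0\}.$$ 2. (Metafinite Alexander polynomials.) Let $lk:\pi\to\mathbb Z$ be the homomorphism with $lk(\mathfrak m)=1$, so $\ker lk=[\pi,\pi]$, let $H$ be a finite group, $B$ a commutative ring, and $r:\ker lk\to H$ an epimorphism that is equivariant for conjugation by $\mathfrak m$ and an automorphism $\varphi$ of $H$. Put $\mathcal A=B[H]$, $\kappa=B[\varphi]$, $\rho(\gamma)=r(\gamma\mathfrak m^{-n})\tau^{n}$ for $n=lk(\gamma)$,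 and let $N>0$ be minimal with $\kappa^N=\mathrm{id}$. The polynomial $\det\circ\Upsilon_*(\Delta_\rho^{K_1})$ is the class in $R^\times/(\mathcal V(R)\cdot\mathcal A^\times)\cup\{0\}$, $R=\mathcal A_{\mathrm{id}}((t))$, of a unit that represents $\mathcal M\circ\Upsilon_*([\tau]^{-g}[A_{F,W}])\in K_1(R)$ (the Whitehead determinant; here $\mathcal V(R)$ is generated by the elements $(1+rs)(1+sr)^{-1}\in R^\times$, and $R^\times/\mathcal V(R)\cong K_1(R)$ for semi-local $R$; in general one unit is chosen once and for all for every class in $K_1(R)$). This polynomial does not depend on the meridian, and it is a knot invariant: if a homeomorphism $\Psi$ of $S^3$ carries $K$, with the tubular neighbourhood and the surface data, to $K'$, and $lk'$, $r'$ correspond to $lk$, $r$ under $\Psi_*$, then for any frames of $K$ and $K'$ also $lk'(\mathfrak m')=1$, $r'$ is equivariant for $\mathfrak m'$, and the two polynomials are equal. (With $\Psi=\mathrm{id}$ this is the independence of the meridian.) 3. (Metabelian Alexander polynomials.) Let $N\ge1$, let $H$ be the torsion subgroup of $H_1(E_K^N;\mathbb Z)$, where $E_K^N$ is the $N$-fold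 cyclic covering of $S^3\setminus K$, and let $r:\ker lk\to H$ be a homomorphism, equivariant for $\mathfrak m$ and some $\varphi$, which sends each element whose homology class is torsion to that class. Put $\mathcal A=\mathbb Q[H]$, $\kappa=\mathbb Q[\varphi]$ and define $\rho$ as before. Then $\kappa^N=\mathrm{id}$, and the polynomial $\det\circ\Upsilon_*(\Delta_\rho^{K_1})\in\mathcal A_{\mathrm{id}}((t))^\times/\mathcal A^\times\cup\{0\}$, formed with this $N$, does not depend on the meridian and is a knot invariant in the sense of 2. -/

import Mathlib

noncomputable section

namespace KnotK1

/-! ## Completed skew Laurent series rings -/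

section SkewLaurentSeries

variable {A : Type*} [Ring A]

/-- The completed skew Laurent ring `A_κ((τ))` (Novikov ring): formal series `∑ aₙ τⁿ`, `n ∈ ℤ`,
with `aₙ ∈ A` and `aₙ = 0` for all sufficiently negative `n`.  The multiplication, defined below,
obeys `τ a = κ(a) τ`. -/
@[ext] structure SkewLaurent (κ : RingAut A) where
  /-- The coefficient `aₙ` of `τⁿ`. -/
  coeff : ℤ → A
  bounded : ∃ m : ℤ, ∀ n < m, coeff n = 0

namespace SkewLaurent

variable {κ : RingAut A}

instance : Zero (SkewLaurent κ) := ⟨⟨fun _ => 0, 0, fun _ _ => rfl⟩⟩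

instance : Add (SkewLaurent κ) := ⟨fun f g => ⟨fun n => f.coeff n + g.coeff n, by
  obtain ⟨a, ha⟩ := f.bounded
  obtain ⟨b, hb⟩ := g.bounded
  exact ⟨min a b, fun n hn => by
    rw [ha n (lt_of_lt_of_le hn (min_le_left _ _)), hb n (lt_of_lt_of_le hn (min_le_right _ _)),
      add_zero]⟩⟩⟩

instance : Neg (SkewLaurent κ) := ⟨fun f => ⟨fun n => -f.coeff n, by
  obtain ⟨a, ha⟩ := f.bounded
  exact ⟨a, fun n hn => by rw [ha n hn, neg_zero]⟩⟩⟩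

@[simp] theorem coeff_zero (n : ℤ) : (0 : SkewLaurent κ).coeff n = 0 := rfl
@[simp] theorem coeff_add (f g : SkewLaurent κ) (n : ℤ) :
    (f + g).coeff n = f.coeff n + g.coeff n := rfl
@[simp] theorem coeff_neg (f : SkewLaurent κ) (n : ℤ) : (-f).coeff n = -f.coeff n := rfl

/-- The monomial `a τⁿ`. -/
def monomial (n : ℤ) (a : A) : SkewLaurent κ where
  coeff k := if k = n then a else 0
  bounded := ⟨n, fun _ hk => if_neg hk.ne⟩

theorem coeff_monomial (n : ℤ) (a : A) (k : ℤ) :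
    (monomial n a : SkewLaurent κ).coeff k = if k = n then a else 0 := rfl

theorem finsum_eq_sum {f g : ℤ → A} {a b n : ℤ} (ha : ∀ i < a, f i = 0)
    (hb : ∀ i, b < i → g (n - i) = 0) :
    ∑ᶠ i : ℤ, f i * (κ ^ i) (g (n - i)) =
      ∑ i ∈ Finset.Icc a b, f i * (κ ^ i) (g (n - i)) := by
  refine finsum_eq_sum_of_support_subset _ fun i hi => ?_
  rw [Finset.coe_Icc, Set.mem_Icc]
  by_contra h
  apply hi
  by_cases h1 : i < a
  · simp [ha i h1]
  · simp [hb i (by by_contra h2; exact h ⟨not_lt.mp h1, not_lt.mp h2⟩)]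

/-- Multiplication: `(∑ aᵢ τⁱ) (∑ bⱼ τʲ) = ∑ₙ (∑ᵢ aᵢ κⁱ(b_{n-i})) τⁿ`, where in each inner sum only
finitely many terms are nonzero. -/
instance : Mul (SkewLaurent κ) := ⟨fun f g =>
  ⟨fun n => ∑ᶠ i : ℤ, f.coeff i * (κ ^ i) (g.coeff (n - i)), by
    obtain ⟨a, ha⟩ := f.bounded
    obtain ⟨b, hb⟩ := g.bounded
    refine ⟨a + b, fun n hn => ?_⟩
    rw [finsum_eq_sum (b := a - 1) ha (fun i hi => hb _ (by omega)), Finset.Icc_eq_empty (by omega),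
      Finset.sum_empty]⟩⟩

theorem coeff_mul_def (f g : SkewLaurent κ) (n : ℤ) :
    (f * g).coeff n = ∑ᶠ i : ℤ, f.coeff i * (κ ^ i) (g.coeff (n - i)) := rfl

theorem coeff_mul {f g : SkewLaurent κ} {a b : ℤ} (n : ℤ) (ha : ∀ i < a, f.coeff i = 0)
    (hb : ∀ i, b < i → g.coeff (n - i) = 0) :
    (f * g).coeff n = ∑ i ∈ Finset.Icc a b, f.coeff i * (κ ^ i) (g.coeff (n - i)) :=
  finsum_eq_sum ha hb

theorem coeff_monomial_mul (m : ℤ) (a : A) (g : SkewLaurent κ) (n : ℤ) :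
    (monomial m a * g).coeff n = a * (κ ^ m) (g.coeff (n - m)) := by
  rw [coeff_mul_def, finsum_eq_single _ m]
  · rw [coeff_monomial, if_pos rfl]
  · intro i hi
    rw [coeff_monomial, if_neg hi, zero_mul]

theorem coeff_mul_monomial (m : ℤ) (a : A) (f : SkewLaurent κ) (n : ℤ) :
    (f * monomial m a).coeff n = f.coeff (n - m) * (κ ^ (n - m)) a := by
  rw [coeff_mul_def, finsum_eq_single _ (n - m)]
  · rw [coeff_monomial, if_pos (by omega)]
  · intro i hi
    rw [coeff_monomial, if_neg (by omega), map_zero, mul_zero]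

protected theorem mul_assoc (f g h : SkewLaurent κ) : f * g * h = f * (g * h) := by
  ext n
  obtain ⟨a, ha⟩ := f.bounded
  obtain ⟨b, hb⟩ := g.bounded
  obtain ⟨c, hc⟩ := h.bounded
  have hfg : ∀ i < a + b, (f * g).coeff i = 0 := fun i hi => by
    rw [coeff_mul (a := a) (b := a - 1) i ha (fun k hk => hb _ (by omega)),
      Finset.Icc_eq_empty (by omega), Finset.sum_empty]
  have hgh : ∀ i < b + c, (g * h).coeff i = 0 := fun i hi => by
    rw [coeff_mul (a := b) (b := b - 1) i hb (fun k hk => hc _ (by omega)),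
      Finset.Icc_eq_empty (by omega), Finset.sum_empty]
  rw [coeff_mul (a := a + b) (b := n - c) n hfg (fun i hi => hc _ (by omega)),
    coeff_mul (a := a) (b := n - b - c) n ha (fun i hi => hgh _ (by omega))]
  have h1 : ∀ i ∈ Finset.Icc (a + b) (n - c), (f * g).coeff i * (κ ^ i) (h.coeff (n - i)) =
      ∑ j ∈ Finset.Icc a (n - b - c), f.coeff j * (κ ^ j) (g.coeff (i - j)) *
        (κ ^ i) (h.coeff (n - i)) := by
    intro i hi
    rw [Finset.mem_Icc] at hi
    rw [coeff_mul (a := a) (b := n - b - c) i ha (fun k hk => hb _ (by omega)), Finset.sum_mul]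
  have h2 : ∀ j ∈ Finset.Icc a (n - b - c), f.coeff j * (κ ^ j) ((g * h).coeff (n - j)) =
      ∑ i ∈ Finset.Icc (a + b) (n - c), f.coeff j * (κ ^ j) (g.coeff (i - j)) *
        (κ ^ i) (h.coeff (n - i)) := by
    intro j hj
    rw [Finset.mem_Icc] at hj
    rw [coeff_mul (a := a + b - j) (b := n - c - j) (n - j) (fun i hi => hb _ (by omega))
      (fun k hk => hc _ (by omega)), map_sum, Finset.mul_sum]
    refine Finset.sum_nbij' (fun i => i + j) (fun i => i - j) ?_ ?_ ?_ ?_ ?_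
    · intro i hi; rw [Finset.mem_Icc] at hi ⊢; omega
    · intro i hi; rw [Finset.mem_Icc] at hi ⊢; omega
    · intro i _; omega
    · intro i _; omega
    · intro i _
      have e1 : i + j - j = i := by omega
      have e2 : n - j - i = n - (i + j) := by omega
      rw [e1, e2, map_mul, mul_assoc, add_comm i j, zpow_add]
      rfl
  rw [Finset.sum_congr rfl h1, Finset.sum_congr rfl h2, Finset.sum_comm]

instance : Ring (SkewLaurent κ) where
  one := monomial 0 1
  add_assoc f g h := by ext n; exact add_assoc _ _ _
  zero_add f := by ext n; exact zero_add _
  add_zero f := by ext n; exact add_zero _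
  add_comm f g := by ext n; exact add_comm _ _
  neg_add_cancel f := by ext n; exact neg_add_cancel _
  nsmul := nsmulRec
  zsmul := zsmulRec
  mul_assoc := SkewLaurent.mul_assoc
  one_mul f := by
    ext n
    refine (coeff_monomial_mul 0 1 f n).trans ?_
    simp
  mul_one f := by
    ext n
    refine (coeff_mul_monomial 0 1 f n).trans ?_
    simp
  zero_mul f := by
    ext n
    rw [coeff_mul_def]
    simp
  mul_zero f := by
    ext n
    rw [coeff_mul_def]
    simp
  left_distrib f g h := by
    ext n
    obtain ⟨a, ha⟩ := f.bounded
    obtain ⟨b, hb⟩ := g.bounded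
    obtain ⟨c, hc⟩ := h.bounded
    rw [coeff_add, coeff_mul (a := a) (b := n - min b c) n ha, coeff_mul (a := a)
      (b := n - min b c) n ha, coeff_mul (a := a) (b := n - min b c) n ha,
      ← Finset.sum_add_distrib]
    · simp only [coeff_add, map_add, mul_add]
    · intro i hi
      exact hc _ (by omega)
    · intro i hi
      exact hb _ (by omega)
    · intro i hi
      rw [coeff_add, hb _ (by omega), hc _ (by omega), add_zero]
  right_distrib f g h := by
    ext n
    obtain ⟨a, ha⟩ := f.bounded
    obtain ⟨b, hb⟩ := g.bounded
    obtain ⟨c, hc⟩ := h.bounded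
    have hh : ∀ i, n - c < i → h.coeff (n - i) = 0 := fun i hi => hc _ (by omega)
    rw [coeff_add, coeff_mul (a := min a b) n _ hh, coeff_mul (a := min a b) n _ hh,
      coeff_mul (a := min a b) n _ hh, ← Finset.sum_add_distrib]
    · simp only [coeff_add, add_mul]
    · intro i hi
      exact hb _ (by omega)
    · intro i hi
      exact ha _ (by omega)
    · intro i hi
      rw [coeff_add, ha _ (by omega), hb _ (by omega), add_zero]

theorem one_eq : (1 : SkewLaurent κ) = monomial 0 1 := rfl

theorem monomial_mul_monomial (m n : ℤ) (a b : A) :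
    (monomial m a * monomial n b : SkewLaurent κ) = monomial (m + n) (a * (κ ^ m) b) := by
  ext k
  rw [coeff_monomial_mul, coeff_monomial, coeff_monomial]
  by_cases h : k = m + n
  · rw [if_pos (by omega), if_pos h]
  · rw [if_neg (by omega), if_neg h, map_zero, mul_zero]

/-- The inclusion `A ↪ A_κ((τ))` of the constant series. -/
def C (κ : RingAut A) : A →+* SkewLaurent κ where
  toFun a := monomial 0 a
  map_one' := rfl
  map_mul' a b := by
    rw [monomial_mul_monomial]
    simp
  map_zero' := by
    ext n
    rw [coeff_monomial, ite_self]
    rfl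
  map_add' a b := by
    ext n
    rw [coeff_add, coeff_monomial, coeff_monomial, coeff_monomial]
    split_ifs <;> simp

/-- The indeterminate `τ`, which is a unit of `A_κ((τ))`. -/
def tau (κ : RingAut A) : (SkewLaurent κ)ˣ where
  val := monomial 1 1
  inv := monomial (-1) 1
  val_inv := by
    rw [monomial_mul_monomial]
    simp [one_eq]
  inv_val := by
    rw [monomial_mul_monomial]
    simp [one_eq]

/-- The defining commutation rule of the skew Laurent ring. -/
theorem tau_mul_C (a : A) : (tau κ : SkewLaurent κ) * C κ a = C κ (κ a) * tau κ := by
  change (monomial 1 1 * monomial 0 a : SkewLaurent κ) = monomial 0 (κ a) * monomial 1 1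
  rw [monomial_mul_monomial, monomial_mul_monomial]
  simp

/-- For commutative `A`, the ring `A_id((t))` is the usual commutative ring of Laurent series. -/
instance {A : Type*} [CommRing A] : CommRing (SkewLaurent (1 : RingAut A)) where
  __ := (inferInstance : Ring (SkewLaurent (1 : RingAut A)))
  mul_comm f g := by
    ext n
    rw [coeff_mul_def, coeff_mul_def]
    refine (finsum_comp_equiv (Equiv.subLeft n)).symm.trans (finsum_congr fun i => ?_)
    simp [mul_comm]

end SkewLaurent

/-! ### The ring homomorphism `Υ` -/

/-- `Υ(f)` for `f = ∑ aₙ τⁿ`: in row `i` and column `j` (`0 ≤ i, j < N`) stands the Laurent series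
in the commuting variable `t` whose `tⁿ`-coefficient is `κ^{N-i}(aₙ)` if `j ≡ i - n` modulo `N`, and
`0` otherwise.  So `Υ(a) = diag(κᴺ(a), …, κ²(a), κ(a))` for `a ∈ A`, and `Υ(τ)` is `t` times the
cyclic permutation matrix with ones just below the diagonal and in the upper right corner. -/
def upsilonFun (κ : RingAut A) (N : ℕ) (f : SkewLaurent κ) :
    Matrix (Fin N) (Fin N) (SkewLaurent (1 : RingAut A)) := Matrix.of fun i j =>
  { coeff := fun n =>
      if (N : ℤ) ∣ (i : ℤ) - j - n then (κ ^ (N - (i : ℕ))) (f.coeff n) else 0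
    bounded := by
      obtain ⟨m, hm⟩ := f.bounded
      exact ⟨m, fun n hn => by rw [hm n hn, map_zero, ite_self]⟩ }

theorem upsilonFun_coeff (κ : RingAut A) (N : ℕ) (f : SkewLaurent κ) (i j : Fin N) (n : ℤ) :
    (upsilonFun κ N f i j).coeff n =
      if (N : ℤ) ∣ (i : ℤ) - j - n then (κ ^ (N - (i : ℕ))) (f.coeff n) else 0 := rfl

theorem zpow_eq_of_dvd {κ : RingAut A} {N : ℕ} (h : κ ^ N = 1) {a b : ℤ} (hab : (N : ℤ) ∣ a - b) :
    κ ^ a = κ ^ b := by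
  obtain ⟨c, hc⟩ := hab
  have : a = N * c + b := by omega
  rw [this, zpow_add, zpow_mul, zpow_natCast, h, one_zpow, one_mul]

theorem coeff_finset_sum {κ : RingAut A} {ι : Type*} (s : Finset ι) (F : ι → SkewLaurent κ)
    (n : ℤ) : (∑ k ∈ s, F k).coeff n = ∑ k ∈ s, (F k).coeff n := by
  classical
  induction s using Finset.induction_on with
  | empty => simp
  | insert a s ha ih => rw [Finset.sum_insert ha, Finset.sum_insert ha, SkewLaurent.coeff_add, ih]

theorem upsilonFun_mul {κ : RingAut A} {N : ℕ} (h : κ ^ N = 1) (f g : SkewLaurent κ) :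
    upsilonFun κ N (f * g) = upsilonFun κ N f * upsilonFun κ N g := by
  ext i j n
  have hN : 0 < N := i.pos
  obtain ⟨a, ha⟩ := f.bounded
  obtain ⟨b, hb⟩ := g.bounded
  have key : ∀ k, (upsilonFun κ N f i k * upsilonFun κ N g k j).coeff n =
      ∑ l ∈ Finset.Icc a (n - b),
        (upsilonFun κ N f i k).coeff l * (upsilonFun κ N g k j).coeff (n - l) := by
    intro k
    rw [SkewLaurent.coeff_mul (a := a) (b := n - b) n]
    · simp
    · intro l hl
      rw [upsilonFun_coeff, ha l hl, map_zero, ite_self]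
    · intro l hl
      rw [upsilonFun_coeff, hb _ (by omega), map_zero, ite_self]
  rw [Matrix.mul_apply, coeff_finset_sum, Finset.sum_congr rfl fun k _ => key k, Finset.sum_comm,
    upsilonFun_coeff, SkewLaurent.coeff_mul (a := a) (b := n - b) n ha
      (fun l hl => hb _ (by omega)), map_sum]
  -- for given `l`, exactly one `k` contributes
  have main : ∀ l, (∑ k : Fin N,
      (upsilonFun κ N f i k).coeff l * (upsilonFun κ N g k j).coeff (n - l)) =
      if (N : ℤ) ∣ (i : ℤ) - j - n then
        (κ ^ (N - (i : ℕ))) (f.coeff l * (κ ^ l) (g.coeff (n - l))) else 0 := by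
    intro l
    have hN' : (0 : ℤ) < N := by exact_mod_cast hN
    have hk0 := Int.emod_nonneg ((i : ℤ) - l) hN'.ne'
    have hk1 := Int.emod_lt_of_pos ((i : ℤ) - l) hN'
    have hd := Int.emod_add_mul_ediv ((i : ℤ) - l) N
    obtain ⟨k0, hk⟩ : ∃ k0 : Fin N, ((k0 : ℕ) : ℤ) = ((i : ℤ) - l) % N :=
      ⟨⟨(((i : ℤ) - l) % N).toNat, by omega⟩, by simp; omega⟩
    have hkd : (N : ℤ) ∣ (i : ℤ) - k0 - l := ⟨((i : ℤ) - l) / N, by rw [hk]; omega⟩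
    rw [Finset.sum_eq_single k0]
    · rw [upsilonFun_coeff, upsilonFun_coeff, if_pos hkd]
      have hiff : (N : ℤ) ∣ (k0 : ℤ) - j - (n - l) ↔ (N : ℤ) ∣ (i : ℤ) - j - n := by
        have e : (i : ℤ) - j - n = ((i : ℤ) - k0 - l) + ((k0 : ℤ) - j - (n - l)) := by ring
        rw [e]
        exact (dvd_add_right hkd).symm
      by_cases hc : (N : ℤ) ∣ (i : ℤ) - j - n
      · rw [if_pos hc, if_pos (hiff.mpr hc), map_mul]
        congr 1
        change _ = ((κ ^ (N - (i : ℕ))) * (κ ^ l)) (g.coeff (n - l))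
        rw [← zpow_natCast, ← zpow_natCast, ← zpow_add]
        congr 1
        apply zpow_eq_of_dvd h
        rw [Nat.cast_sub k0.2.le, Nat.cast_sub i.2.le]
        have e : (N : ℤ) - (k0 : ℕ) - ((N : ℤ) - (i : ℕ) + l) = (i : ℤ) - k0 - l := by ring
        exact e ▸ hkd
      · rw [if_neg hc, if_neg (fun h => hc (hiff.mp h)), mul_zero]
    · intro k _ hne
      rw [upsilonFun_coeff κ N f, if_neg, zero_mul]
      intro hdk
      apply hne
      have h3 : (N : ℤ) ∣ (k : ℤ) - k0 := by
        have e : (k : ℤ) - k0 = (i : ℤ) - k0 - l - ((i : ℤ) - k - l) := by ring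
        exact e ▸ dvd_sub hkd hdk
      have h4 := Int.eq_zero_of_abs_lt_dvd h3 (by
        have := k.2
        have := k0.2
        rw [abs_lt]
        omega)
      exact Fin.ext (by omega)
    · intro hmem
      exact absurd (Finset.mem_univ _) hmem
  rw [Finset.sum_congr rfl fun l _ => main l]
  split_ifs with hc
  · rfl
  · simp

/-- The ring homomorphism `Υ : A_κ((τ)) → Mat(N × N, A_id((t)))`, defined when `κᴺ = id`. -/
def upsilon {κ : RingAut A} {N : ℕ} (h : κ ^ N = 1) :
    SkewLaurent κ →+* Matrix (Fin N) (Fin N) (SkewLaurent (1 : RingAut A)) where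
  toFun := upsilonFun κ N
  map_one' := by
    ext i j n
    rw [upsilonFun_coeff, SkewLaurent.one_eq, SkewLaurent.coeff_monomial, Matrix.one_apply]
    by_cases hn : n = 0
    · subst hn
      by_cases hij : i = j
      · subst hij
        simp [SkewLaurent.one_eq, SkewLaurent.coeff_monomial]
      · rw [if_neg, if_neg hij]
        · rfl
        · intro hd
          have h4 := Int.eq_zero_of_abs_lt_dvd hd (by
            have := i.2
            have := j.2
            rw [abs_lt]
            omega)
          exact hij (Fin.ext (by omega))
    · rw [if_neg hn, map_zero, ite_self]
      split_ifs
      · rw [SkewLaurent.one_eq, SkewLaurent.coeff_monomial, if_neg hn]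
      · rfl
  map_mul' := upsilonFun_mul h
  map_zero' := by
    ext i j n
    rw [upsilonFun_coeff]
    simp
  map_add' f g := by
    ext i j n
    rw [Matrix.add_apply, SkewLaurent.coeff_add, upsilonFun_coeff, upsilonFun_coeff,
      upsilonFun_coeff, SkewLaurent.coeff_add, map_add]
    split_ifs <;> simp

end SkewLaurentSeries

/-! ## The group `K₁` -/

section KOne

/-- The stabilisation `M ↦ diag(M, 1, …, 1)` of square matrices from size `n` to size `m ≥ n`. -/
def stab (R : Type*) [Ring R] (n m : ℕ) (h : n ≤ m) :
    Matrix (Fin n) (Fin n) R →* Matrix (Fin m) (Fin m) R where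
  toFun M := Matrix.of fun i j =>
    if hij : (i : ℕ) < n ∧ (j : ℕ) < n then M ⟨i, hij.1⟩ ⟨j, hij.2⟩ else if i = j then 1 else 0
  map_one' := by
    ext i j
    simp only [Matrix.of_apply, Matrix.one_apply, Fin.ext_iff]
    split_ifs <;> rfl
  map_mul' M M' := by
    ext i j
    rw [Matrix.mul_apply]
    simp only [Matrix.of_apply]
    have hcast : ∀ F : Fin m → R, (∀ k : Fin m, ¬ (k : ℕ) < n → F k = 0) →
        ∑ k, F k = ∑ k : Fin n, F (Fin.castLE h k) := by
      intro F hF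
      refine (Finset.sum_subset (Finset.subset_univ (Finset.univ.map (Fin.castLEEmb h)))
        fun k _ hk => hF k fun hlt => hk ?_).symm.trans (Finset.sum_map _ _ _)
      rw [Finset.mem_map]
      exact ⟨⟨k, hlt⟩, Finset.mem_univ _, rfl⟩
    by_cases hi : (i : ℕ) < n
    · rw [hcast]
      · by_cases hj : (j : ℕ) < n
        · rw [dif_pos ⟨hi, hj⟩, Matrix.mul_apply]
          refine Finset.sum_congr rfl fun k _ => ?_
          rw [dif_pos ⟨hi, k.2⟩, dif_pos ⟨k.2, hj⟩]
          rfl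
        · rw [dif_neg (fun h => hj h.2), if_neg (fun e : i = j => hj (e ▸ hi))]
          symm
          refine Finset.sum_eq_zero fun k _ => ?_
          rw [dif_neg (c := (Fin.castLE h k : ℕ) < n ∧ (j : ℕ) < n) (fun h => hj h.2),
            if_neg (c := Fin.castLE h k = j) (fun e => hj (e ▸ k.2)), mul_zero]
      · intro k hk
        rw [dif_neg (fun h => hk h.2), if_neg (fun e : i = k => hk (e ▸ hi)), zero_mul]
    · rw [dif_neg (fun h => hi h.1), Finset.sum_eq_single i]
      · rw [dif_neg (fun h => hi h.1), if_pos rfl, one_mul, dif_neg (fun h => hi h.1)]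
      · intro k _ hk
        rw [dif_neg (fun h => hi h.1), if_neg hk.symm, zero_mul]
      · intro hmem
        exact absurd (Finset.mem_univ _) hmem

theorem stab_apply {R : Type*} [Ring R] {n m : ℕ} (h : n ≤ m) (M : Matrix (Fin n) (Fin n) R)
    (i j : Fin m) : stab R n m h M i j =
      if hij : (i : ℕ) < n ∧ (j : ℕ) < n then M ⟨i, hij.1⟩ ⟨j, hij.2⟩
      else if i = j then 1 else 0 := rfl

/-- `GL n R`, for a possibly noncommutative ring `R`. -/
abbrev GLn (R : Type*) [Ring R] (n : ℕ) := (Matrix (Fin n) (Fin n) R)ˣ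

/-- The injection `GL_n(R) → GL_m(R)`, `n ≤ m`. -/
def glStab (R : Type*) [Ring R] (n m : ℕ) (h : n ≤ m) : GLn R n →* GLn R m :=
  Units.map (stab R n m h)

instance (R : Type*) [Ring R] :
    DirectedSystem (GLn R) (fun _ _ h => (glStab R _ _ h : GLn R _ → GLn R _)) where
  map_self n M := by
    ext i j
    change stab R n n le_rfl M.1 i j = M.1 i j
    rw [stab_apply, dif_pos ⟨i.2, j.2⟩]
  map_map k j i hkj hji M := by
    ext a b
    change stab R _ _ _ (stab R _ _ _ M.1) a b = stab R _ _ _ M.1 a b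
    rw [stab_apply, stab_apply]
    by_cases hab : (a : ℕ) < i ∧ (b : ℕ) < i
    · rw [dif_pos hab, dif_pos ⟨hab.1.trans_le hkj, hab.2.trans_le hkj⟩, stab_apply, dif_pos hab]
    · rw [dif_neg hab]
      by_cases hab' : (a : ℕ) < j ∧ (b : ℕ) < j
      · rw [dif_pos hab', stab_apply, dif_neg hab]
        simp only [Fin.ext_iff]
      · rw [dif_neg hab']

/-- `GL(R)`, the colimit of the groups `GL_n(R)`. -/
abbrev GLInf (R : Type*) [Ring R] := DirectLimit (GLn R) (glStab R)

/-- `K₁(R) = GL(R) / [GL(R), GL(R)]`. -/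
abbrev K1 (R : Type*) [Ring R] := Abelianization (GLInf R)

namespace K1

variable {R S : Type*} [Ring R] [Ring S]

/-- The canonical map `GL_n(R) → GL(R)`. -/
def toGLInf (n : ℕ) : GLn R n →* GLInf R where
  toFun M := ⟦⟨n, M⟩⟧
  map_one' := (DirectLimit.one_def (f := glStab R) n).symm
  map_mul' M M' := (DirectLimit.mul_def (f := glStab R) n M M').symm

/-- The class in `K₁(R)` of an invertible matrix. -/
def mk (n : ℕ) : GLn R n →* K1 R := Abelianization.of.comp (toGLInf n)

/-- The class in `K₁(R)` of a unit of `R`, regarded as a `1 × 1` matrix. -/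
def unit : Rˣ →* K1 R := (mk 1).comp (Units.map (Matrix.scalar (Fin 1)).toMonoidHom)

theorem toGLInf_stab {n m : ℕ} (h : n ≤ m) (M : GLn R n) :
    toGLInf m (glStab R n m h M) = toGLInf n M :=
  DirectLimit.mk_apply (f := glStab R) n m M h

theorem mk_stab {n m : ℕ} (h : n ≤ m) (M : GLn R n) : mk m (glStab R n m h M) = mk n M :=
  congrArg Abelianization.of (toGLInf_stab h M)

/-- A compatible family of homomorphisms from the groups `GL_n(R)` to a commutative group induces a
homomorphism from `K₁(R)`. -/
def lift {G : Type*} [CommGroup G] (F : ∀ n, GLn R n →* G)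
    (hF : ∀ n m (h : n ≤ m) (M : GLn R n), F n M = F m (glStab R n m h M)) : K1 R →* G :=
  Abelianization.lift
    { toFun := DirectLimit.lift (glStab R) (fun n M => F n M) hF
      map_one' := DirectLimit.lift_one (f := glStab R) F hF
      map_mul' := DirectLimit.lift_mul (f := glStab R) F hF }

@[simp] theorem lift_mk {G : Type*} [CommGroup G] (F : ∀ n, GLn R n →* G)
    (hF : ∀ n m (h : n ≤ m) (M : GLn R n), F n M = F m (glStab R n m h M)) (n : ℕ)
    (M : GLn R n) : lift F hF (mk n M) = F n M := by
  rfl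

theorem hom_ext {G : Type*} [CommGroup G] {φ ψ : K1 R →* G}
    (h : ∀ n (M : GLn R n), φ (mk n M) = ψ (mk n M)) : φ = ψ := by
  refine Abelianization.hom_ext _ _ (MonoidHom.ext fun x => ?_)
  induction x using DirectLimit.induction with
  | ih n M => exact h n M

/-- Functoriality of `K₁`. -/
def map (f : R →+* S) : K1 R →* K1 S :=
  lift (fun n => (mk n).comp (Units.map f.mapMatrix.toMonoidHom)) (by
    intro n m h M
    change mk n _ = mk m _
    rw [← mk_stab h]
    congr 1
    ext i j
    change stab S n m h (f.mapMatrix M.1) i j = f (stab R n m h M.1 i j)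
    rw [stab_apply, stab_apply]
    split_ifs <;> simp)

theorem map_mk (f : R →+* S) (n : ℕ) (M : GLn R n) :
    map f (mk n M) = mk n (Units.map f.mapMatrix.toMonoidHom M) := rfl

/-- The ring isomorphism which regards an `n × n` matrix of `N × N` matrices as an `nN × nN`
matrix. -/
def flatten (R : Type*) [Ring R] (N n : ℕ) :
    Matrix (Fin n) (Fin n) (Matrix (Fin N) (Fin N) R) ≃+* Matrix (Fin (n * N)) (Fin (n * N)) R :=
  (Matrix.compRingEquiv (Fin n) (Fin N) R).trans (Matrix.reindexRingEquiv R finProdFinEquiv)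

theorem flatten_apply {N n : ℕ} (M : Matrix (Fin n) (Fin n) (Matrix (Fin N) (Fin N) R))
    (p q : Fin (n * N)) :
    flatten R N n M p q = M p.divNat q.divNat p.modNat q.modNat := rfl

/-- The Morita isomorphism `𝓜 : K₁(Mat(N × N, R)) → K₁(R)`, which regards an invertible
matrix of `N × N` matrices as an invertible matrix over `R`. -/
def morita (R : Type*) [Ring R] (N : ℕ) : K1 (Matrix (Fin N) (Fin N) R) →* K1 R :=
  lift (fun n => (mk (n * N)).comp (Units.map (flatten R N n).toMonoidHom)) (by
    intro n m h M
    change mk (n * N) _ = mk (m * N) _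
    rw [← mk_stab (Nat.mul_le_mul_right N h)]
    congr 1
    ext p q
    change stab R _ _ _ (flatten R N n M.1) p q = flatten R N m (stab _ n m h M.1) p q
    rw [stab_apply, flatten_apply, stab_apply]
    have hN : 0 < N := by
      rcases Nat.eq_zero_or_pos N with rfl | hN
      · exact absurd p.2 (by simp)
      · exact hN
    have hp : ((p : ℕ) < n * N) ↔ ((p.divNat : Fin m) : ℕ) < n := by
      rw [Fin.coe_divNat, Nat.div_lt_iff_lt_mul hN]
    have hq : ((q : ℕ) < n * N) ↔ ((q.divNat : Fin m) : ℕ) < n := by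
      rw [Fin.coe_divNat, Nat.div_lt_iff_lt_mul hN]
    by_cases hc : (p : ℕ) < n * N ∧ (q : ℕ) < n * N
    · rw [dif_pos hc, dif_pos ⟨hp.mp hc.1, hq.mp hc.2⟩, flatten_apply]
      rfl
    · rw [dif_neg hc, dif_neg (fun h => hc ⟨hp.mpr h.1, hq.mpr h.2⟩)]
      have hpq : p = q ↔ p.divNat = q.divNat ∧ p.modNat = q.modNat := by
        rw [← finProdFinEquiv.symm.injective.eq_iff]
        exact Prod.ext_iff
      by_cases hd : p.divNat = q.divNat
      · rw [if_pos hd, Matrix.one_apply]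
        simp only [hpq, hd, true_and]
      · rw [if_neg hd, if_neg (fun h => hd (hpq.mp h).1)]
        rfl)

theorem morita_mk (N n : ℕ) (M : GLn (Matrix (Fin N) (Fin N) R) n) :
    morita R N (mk n M) = mk (n * N) (Units.map (flatten R N n).toMonoidHom M) := rfl

/-- The determinant `K₁(R) → Rˣ` of a commutative ring. -/
def det (R : Type*) [CommRing R] : K1 R →* Rˣ :=
  lift (fun n => Units.map (Matrix.detMonoidHom (n := Fin n) (R := R))) (by
    intro n m h M
    ext
    change M.1.det = (stab R n m h M.1).det
    obtain ⟨d, rfl⟩ := Nat.exists_eq_add_of_le h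
    have : stab R n (n + d) h M.1 =
        (Matrix.fromBlocks M.1 0 0 1).submatrix finSumFinEquiv.symm finSumFinEquiv.symm := by
      ext i j
      rw [stab_apply, Matrix.submatrix_apply]
      induction i using Fin.addCases with
      | left i =>
        induction j using Fin.addCases with
        | left j => simp
        | right j => simp [Fin.ext_iff]; omega
      | right i =>
        induction j using Fin.addCases with
        | left j => simp [Fin.ext_iff]; omega
        | right j => simp [Matrix.one_apply]
    rw [this, Matrix.det_submatrix_equiv_self, Matrix.det_fromBlocks_zero₂₁, Matrix.det_one,
      mul_one])

end K1

end KOne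

/-! ## The quotient group `𝒬_{A,κ}` and the map `𝓜 ∘ Υ_*` -/

section Container

variable {A : Type*} [Ring A]

/-- `𝒬_{A,κ} = K₁(A_κ((τ))) / K₁(A)`: the cokernel of the map induced by `A ↪ A_κ((τ))`. -/
abbrev Container (κ : RingAut A) := K1 (SkewLaurent κ) ⧸ (K1.map (SkewLaurent.C κ)).range

/-- `𝓜 ∘ Υ_* : K₁(A_κ((τ))) → K₁(A_id((t)))`. -/
def moritaUpsilon {κ : RingAut A} {N : ℕ} (h : κ ^ N = 1) :
    K1 (SkewLaurent κ) →* K1 (SkewLaurent (1 : RingAut A)) :=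
  (K1.morita _ N).comp (K1.map (upsilon h))

/-- The homomorphism `a ↦ diag(κᴺ(a), …, κ(a))`, the restriction of `Υ` to `A`. -/
def diagHom (κ : RingAut A) (N : ℕ) : A →+* Matrix (Fin N) (Fin N) A :=
  (Matrix.diagonalRingHom (Fin N) A).comp
    (RingHom.pi fun i : Fin N => ((κ ^ (N - (i : ℕ)) : RingAut A) : A →+* A))

theorem upsilon_C {κ : RingAut A} {N : ℕ} (h : κ ^ N = 1) (a : A) :
    upsilon h (SkewLaurent.C κ a) =
      (SkewLaurent.C (1 : RingAut A)).mapMatrix (diagHom κ N a) := by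
  ext i j n
  change (upsilonFun κ N (SkewLaurent.monomial 0 a) i j).coeff n =
    (SkewLaurent.monomial 0 (Matrix.diagonal (fun i : Fin N => (κ ^ (N - (i : ℕ))) a) i j)).coeff n
  rw [upsilonFun_coeff, SkewLaurent.coeff_monomial, SkewLaurent.coeff_monomial,
    Matrix.diagonal_apply]
  by_cases hn : n = 0
  · subst hn
    by_cases hij : i = j
    · subst hij
      simp
    · rw [if_neg, if_neg hij, ite_self]
      intro hd
      have h4 := Int.eq_zero_of_abs_lt_dvd hd (by
        have := i.2
        have := j.2
        rw [abs_lt]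
        omega)
      exact hij (Fin.ext (by omega))
  · rw [if_neg hn, if_neg hn, map_zero, ite_self]

theorem moritaUpsilon_C {κ : RingAut A} {N : ℕ} (h : κ ^ N = 1) (k : K1 A) :
    moritaUpsilon h (K1.map (SkewLaurent.C κ) k) =
      K1.map (SkewLaurent.C (1 : RingAut A)) (K1.morita A N (K1.map (diagHom κ N) k)) := by
  have : (moritaUpsilon h).comp (K1.map (SkewLaurent.C κ)) =
      (K1.map (SkewLaurent.C (1 : RingAut A))).comp
        ((K1.morita A N).comp (K1.map (diagHom κ N))) := by
    refine K1.hom_ext fun n M => ?_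
    simp only [MonoidHom.comp_apply, moritaUpsilon, K1.map_mk, K1.morita_mk]
    congr 1
    ext p q : 2
    change upsilon h (SkewLaurent.C κ (M.1 p.divNat q.divNat)) p.modNat q.modNat =
      SkewLaurent.C 1 (diagHom κ N (M.1 p.divNat q.divNat) p.modNat q.modNat)
    rw [upsilon_C]
    rfl
  exact DFunLike.congr_fun this k

/-- `det ∘ Υ_* : K₁(A_κ((τ))) → A_id((t))ˣ`, for a commutative ring `A`. -/
def detUpsilon {A : Type*} [CommRing A] {κ : RingAut A} {N : ℕ} (h : κ ^ N = 1) :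
    K1 (SkewLaurent κ) →* (SkewLaurent (1 : RingAut A))ˣ :=
  (K1.det (SkewLaurent (1 : RingAut A))).comp (moritaUpsilon h)

/-- The quotient group `A_id((t))ˣ / Aˣ`. -/
abbrev DetContainer (A : Type*) [CommRing A] :=
  (SkewLaurent (1 : RingAut A))ˣ ⧸ (Units.map (SkewLaurent.C (1 : RingAut A)).toMonoidHom).range

/-- The induced map `𝓜 ∘ Υ_* : 𝒬_{A,κ} → 𝒬_{A,id}`. -/
def containerMap {κ : RingAut A} {N : ℕ} (h : κ ^ N = 1) :
    Container κ →* Container (1 : RingAut A) :=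
  QuotientGroup.map _ _ (moritaUpsilon h) (by
    rintro _ ⟨k, rfl⟩
    exact ⟨_, (moritaUpsilon_C h k).symm⟩)

end Container

/-! ## Fox derivatives and the `K₁`-Alexander invariant -/

section Fox

/-- The integral group ring. -/
abbrev IntGroupRing (G : Type*) [Group G] := MonoidAlgebra ℤ G

/-- A free group acting on the additive group of its group ring by left multiplication. -/
def leftMulAction (F : Type*) [Group F] : F →* MulAut (Multiplicative (IntGroupRing F)) where
  toFun w :=
    { toFun := fun a => Multiplicative.ofAdd (MonoidAlgebra.of ℤ F w * a.toAdd)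
      invFun := fun a => Multiplicative.ofAdd (MonoidAlgebra.of ℤ F w⁻¹ * a.toAdd)
      left_inv := fun a => by
        apply Multiplicative.toAdd.injective
        simp only [toAdd_ofAdd, ← mul_assoc, ← map_mul, inv_mul_cancel, map_one, one_mul]
      right_inv := fun a => by
        apply Multiplicative.toAdd.injective
        simp only [toAdd_ofAdd, ← mul_assoc, ← map_mul, mul_inv_cancel, map_one, one_mul]
      map_mul' := fun a b => by
        apply Multiplicative.toAdd.injective
        simp only [toAdd_ofAdd, toAdd_mul, mul_add] }
  map_one' := by
    refine MulEquiv.ext fun a => ?_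
    apply Multiplicative.toAdd.injective
    change MonoidAlgebra.of ℤ F 1 * a.toAdd = a.toAdd
    rw [map_one, one_mul]
  map_mul' v w := by
    refine MulEquiv.ext fun a => ?_
    apply Multiplicative.toAdd.injective
    change MonoidAlgebra.of ℤ F (v * w) * a.toAdd =
      MonoidAlgebra.of ℤ F v * (MonoidAlgebra.of ℤ F w * a.toAdd)
    rw [map_mul, mul_assoc]

variable {α : Type*} [DecidableEq α]

/-- The homomorphism `w ↦ (∂w/∂xᵢ, w)` from the free group to `ℤ[F] ⋊ F`. -/
def foxHom (i : α) : FreeGroup α →*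
    Multiplicative (IntGroupRing (FreeGroup α)) ⋊[leftMulAction (FreeGroup α)] FreeGroup α :=
  FreeGroup.lift fun j => ⟨Multiplicative.ofAdd (if j = i then 1 else 0), FreeGroup.of j⟩

/-- The Fox derivative `∂w/∂xᵢ ∈ ℤ[F]` of an element `w` of the free group `F`; it is characterised
by `foxDeriv_of` and `foxDeriv_mul`. -/
def foxDeriv (i : α) (w : FreeGroup α) : IntGroupRing (FreeGroup α) :=
  (foxHom i w).left.toAdd

theorem foxDeriv_of (i j : α) : foxDeriv i (FreeGroup.of j) = if j = i then 1 else 0 := by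
  simp [foxDeriv, foxHom]

theorem foxHom_right (i : α) (w : FreeGroup α) : (foxHom i w).right = w := by
  have : (SemidirectProduct.rightHom.comp (foxHom i)) = MonoidHom.id (FreeGroup α) := by
    ext j
    simp [foxHom]
  exact DFunLike.congr_fun this w

theorem foxDeriv_mul (i : α) (v w : FreeGroup α) :
    foxDeriv i (v * w) = foxDeriv i v + MonoidAlgebra.of ℤ _ v * foxDeriv i w := by
  unfold foxDeriv
  rw [map_mul, SemidirectProduct.mul_left, foxHom_right]
  rfl

end Fox

section Alexander

variable {A : Type*} [Ring A] {κ : RingAut A} {G : Type*} [Group G]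

/-- Data of a presentation `⟨x₁, …, x_{2g}, 𝔪 ∣ 𝔪 yⱼ 𝔪⁻¹ = zⱼ⟩`, as read off in a group `G`: the
elements `𝔪` and `xᵢ` of `G`, and the words `yⱼ`, `zⱼ` in the letters `x₁, …, x_{2g}`. -/
structure Presentation (G : Type*) [Group G] (g : ℕ) where
  meridian : G
  x : Fin (2 * g) → G
  y : Fin (2 * g) → FreeGroup (Fin (2 * g))
  z : Fin (2 * g) → FreeGroup (Fin (2 * g))

variable {g : ℕ}

/-- Assumption (†) on `ρ : ℤ[G] → A_κ((τ))`: it sends `𝔪` to `τ` and each `xᵢ` into `A`. -/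
def Dagger (P : Presentation G g) (ρ : IntGroupRing G →+* SkewLaurent κ) : Prop :=
  ρ (MonoidAlgebra.of ℤ G P.meridian) = SkewLaurent.tau κ ∧
    ∀ i, ∃ a : A, ρ (MonoidAlgebra.of ℤ G (P.x i)) = SkewLaurent.C κ a

/-- The composite `ℤ[F] → ℤ[G] → A_κ((τ))`, where `F → G` evaluates words at `x₁, …, x_{2g}`. -/
def evalWords (P : Presentation G g) (ρ : IntGroupRing G →+* SkewLaurent κ) :
    IntGroupRing (FreeGroup (Fin (2 * g))) →+* SkewLaurent κ :=
  ρ.comp (MonoidAlgebra.mapDomainRingHom ℤ (FreeGroup.lift P.x))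

/-- The Jacobian matrix `{τ ρ(∂yⱼ/∂xᵢ) - ρ(∂zⱼ/∂xᵢ)}`, with row index `j` and column index `i`. -/
def alexMatrix (P : Presentation G g) (ρ : IntGroupRing G →+* SkewLaurent κ) :
    Matrix (Fin (2 * g)) (Fin (2 * g)) (SkewLaurent κ) := Matrix.of fun j i =>
  SkewLaurent.tau κ * evalWords P ρ (foxDeriv i (P.y j)) - evalWords P ρ (foxDeriv i (P.z j))

open Classical in
/-- `[τ]^{-g} · [alexMatrix] ∈ K₁(A_κ((τ)))` if the matrix is invertible, and an additional element
`0` otherwise. -/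
def alexClass (P : Presentation G g) (ρ : IntGroupRing G →+* SkewLaurent κ) :
    WithZero (K1 (SkewLaurent κ)) :=
  if h : IsUnit (alexMatrix P ρ) then
    ((K1.unit (SkewLaurent.tau κ) ^ (-(g : ℤ)) * K1.mk (2 * g) h.unit : K1 (SkewLaurent κ)) :
      WithZero (K1 (SkewLaurent κ)))
  else 0

/-- The `K₁`-Alexander invariant `Δ_ρ^{K₁} ∈ 𝒬_{A,κ} ∪ {0}`. -/
def alexInvariant (P : Presentation G g) (ρ : IntGroupRing G →+* SkewLaurent κ) :
    WithZero (Container κ) :=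
  WithZero.map' (QuotientGroup.mk' _) (alexClass P ρ)

/-- The relation "`(κ', ρ')` is what becomes of `(κ, ρ)` when `𝔪'` is chosen as the meridian":
`ρ(𝔪') = c τ` for a unit `c` of `A` (as `ρ(𝔪) = τ` and the values of `ρ` on the other generators
lie in `A`, this holds whenever `𝔪'` is conjugate to `𝔪`), `κ'` is the conjugation `a ↦ c κ(a) c⁻¹`
of `A` by `τ' = c τ`, and `ρ'(γ)` is the series `ρ(γ)` rewritten as a series in `τ'`:
if `ρ'(γ) = ∑ aₙ τ'ⁿ`, then `ρ(γ) = ∑ aₙ ρ(𝔪')ⁿ`, where `ρ(𝔪')ⁿ = (c τ)ⁿ` is a monomial of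
degree `n`. -/
def IsMeridianChange {κ κ' : RingAut A} (ρ : IntGroupRing G →+* SkewLaurent κ) (m' : G)
    (ρ' : IntGroupRing G →+* SkewLaurent κ') : Prop :=
  (∃ c : Aˣ, ρ (MonoidAlgebra.of ℤ G m') = SkewLaurent.C κ c * SkewLaurent.tau κ ∧
    ∀ a, κ' a = c * κ a * (c⁻¹ : Aˣ)) ∧
  ∀ (γ : G) (n : ℤ), (ρ (MonoidAlgebra.of ℤ G γ)).coeff n =
    (ρ' (MonoidAlgebra.of ℤ G γ)).coeff n * (ρ (MonoidAlgebra.of ℤ G (m' ^ n))).coeff n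

end Alexander

/-! ## Metafinite and metabelian polynomials -/

section Metafinite

/-- The automorphism of the group ring `B[H]` induced by an automorphism of the group `H`. -/
def groupRingAut (B : Type*) [CommRing B] {H : Type*} [Group H] :
    MulAut H →* RingAut (MonoidAlgebra B H) where
  toFun φ := MonoidAlgebra.mapDomainRingEquiv B φ
  map_one' := by
    refine RingEquiv.ext fun a => ?_
    exact DFunLike.congr_fun (MonoidAlgebra.mapDomainRingHom_id (R := B) (M := H)) a
  map_mul' φ ψ := by
    refine RingEquiv.ext fun a => ?_
    exact DFunLike.congr_fun
      (MonoidAlgebra.mapDomainRingHom_comp (R := B) (φ : H →* H) (ψ : H →* H)) a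

theorem groupRingAut_zpow_of (B : Type*) [CommRing B] {H : Type*} [Group H] (φ : MulAut H)
    (n : ℤ) (a : H) : ((groupRingAut B φ) ^ n) (MonoidAlgebra.of B H a) =
      MonoidAlgebra.of B H ((φ ^ n) a) := by
  rw [← map_zpow]
  exact MonoidAlgebra.mapDomain_single

variable {G : Type*} [Group G] {H : Type*} [Group H]

/-- `r : ker(lk) → H` is equivariant for conjugation by `m` on the kernel and `φ` on `H`. -/
def IsEquivariant {lk : G →* Multiplicative ℤ} (r : lk.ker →* H) (m : G) (φ : MulAut H) : Prop :=
  ∀ γ : lk.ker, r (MulAut.conjNormal m γ) = φ (r γ)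

theorem IsEquivariant.zpow {lk : G →* Multiplicative ℤ} {r : lk.ker →* H} {m : G} {φ : MulAut H}
    (h : IsEquivariant r m φ) (n : ℤ) (γ : lk.ker) :
    r (MulAut.conjNormal (m ^ n) γ) = (φ ^ n) (r γ) := by
  induction n using Int.induction_on generalizing γ with
  | zero => simp
  | succ k ih =>
    rw [zpow_add_one, zpow_add_one, map_mul, MulAut.mul_apply, MulAut.mul_apply, ih, h]
  | pred k ih =>
    rw [zpow_sub_one, zpow_sub_one, map_mul, MulAut.mul_apply, MulAut.mul_apply, ih]
    congr 1
    apply φ.injective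
    rw [MulAut.apply_inv_self, ← h, map_inv, MulAut.apply_inv_self]

theorem mul_zpow_mem_ker {lk : G →* Multiplicative ℤ} {m : G}
    (hm : lk m = Multiplicative.ofAdd 1) (γ : G) : γ * m ^ (-(lk γ).toAdd) ∈ lk.ker := by
  rw [MonoidHom.mem_ker, map_mul, map_zpow, hm, ← ofAdd_zsmul]
  simp

/-- The representation `ρ : ℤ[G] → B[H]_κ((τ))`, `κ = B[φ]`, defined by an equivariant
`r : ker(lk) → H` and an element `m` with `lk(m) = 1`:
`ρ(γ) = r(γ m⁻ⁿ) τⁿ` with `n = lk(γ)`.  So `ρ` is `r` on `ker(lk)`, and `ρ(m) = τ`. -/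
def inducedRep (B : Type*) [CommRing B] {lk : G →* Multiplicative ℤ} (r : lk.ker →* H) {m : G}
    {φ : MulAut H} (hm : lk m = Multiplicative.ofAdd 1) (hr : IsEquivariant r m φ) :
    IntGroupRing G →+* SkewLaurent (groupRingAut B φ) :=
  MonoidAlgebra.liftNCRingHom (Int.castRingHom _)
    { toFun := fun γ => SkewLaurent.monomial (lk γ).toAdd
        (MonoidAlgebra.of B H (r ⟨γ * m ^ (-(lk γ).toAdd), mul_zpow_mem_ker hm γ⟩))
      map_one' := by
        have : (⟨1 * m ^ (-(lk 1).toAdd), mul_zpow_mem_ker hm 1⟩ : lk.ker) = 1 := by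
          ext
          simp
        rw [this, map_one r, map_one lk, map_one (MonoidAlgebra.of B H)]
        rfl
      map_mul' := fun γ δ => by
        rw [SkewLaurent.monomial_mul_monomial, groupRingAut_zpow_of, ← map_mul, ← hr.zpow,
          ← map_mul]
        congr 1
        · rw [map_mul, toAdd_mul]
        · congr 2
          ext
          simp only [Subgroup.coe_mul, MulAut.conjNormal_apply, map_mul, toAdd_mul]
          group }
    (fun n γ => Int.cast_commute n _)

/-- The group `V(R) ⊆ Rˣ` generated by the elements `(1 + r s)(1 + s r)⁻¹`. -/
def vaserstein (R : Type*) [Ring R] : Subgroup Rˣ :=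
  Subgroup.closure {w | ∃ (r s : R) (u v : Rˣ), (u : R) = 1 + r * s ∧ (v : R) = 1 + s * r ∧
    w = u * v⁻¹}

open Classical in
/-- The Whitehead determinant on `K₁(R)`, for a semi-local ring `R`: the inverse of the isomorphism
`Rˣ / V(R) ≅ K₁(R)` that sends a unit to the class of the corresponding `1 × 1` matrix; that is,
the coset of a unit that represents the given class. -/
def whiteheadDet {R : Type*} [Ring R] (k : K1 R) : Rˣ ⧸ vaserstein R :=
  QuotientGroup.mk (Classical.epsilon fun u : Rˣ => K1.unit u = k)

variable {g : ℕ}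

/-- The subgroup `V(R) · Aˣ` of `Rˣ`, where `R = A_id((t))`. -/
def detIndeterminacy (A : Type*) [Ring A] : Subgroup (SkewLaurent (1 : RingAut A))ˣ :=
  vaserstein _ ⊔ (Units.map (SkewLaurent.C (1 : RingAut A)).toMonoidHom).range

/-- The metafinite Alexander polynomial `det ∘ Υ_* (Δ_ρ^{K₁})` over `A = B[H]`, where `ρ` is induced
by `r : ker(lk) → H` and `Υ` is formed with the least `N > 0` such that `κᴺ = id`.  It is the class
of a unit of `A_id((t))` modulo `V` and `Aˣ`, or `0`. -/
def metafinitePolynomial (B : Type*) [CommRing B] {lk : G →* Multiplicative ℤ}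
    (P : Presentation G g) (r : lk.ker →* H) {φ : MulAut H}
    (hm : lk P.meridian = Multiplicative.ofAdd 1) (hr : IsEquivariant r P.meridian φ) :
    WithZero ((SkewLaurent (1 : RingAut (MonoidAlgebra B H)))ˣ ⧸
      detIndeterminacy (MonoidAlgebra B H)) :=
  WithZero.recZeroCoe 0
    (fun k => ((Subgroup.quotientMapOfLE le_sup_left
      (whiteheadDet (moritaUpsilon (pow_orderOf_eq_one (groupRingAut B φ)) k)) :
        (SkewLaurent (1 : RingAut (MonoidAlgebra B H)))ˣ ⧸
          detIndeterminacy (MonoidAlgebra B H)) : WithZero _))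
    (alexClass P (inducedRep B r hm hr))

/-- The fundamental group of the `N`-fold cyclic covering: the elements of `G` whose image under
`lk : G → ℤ` is divisible by `N`. -/
def cyclicSubgroup (lk : G →* Multiplicative ℤ) (N : ℕ) : Subgroup G :=
  (Subgroup.zpowers (Multiplicative.ofAdd (N : ℤ))).comap lk

theorem ker_le_cyclicSubgroup (lk : G →* Multiplicative ℤ) (N : ℕ) :
    lk.ker ≤ cyclicSubgroup lk N := fun γ hγ => by
  rw [MonoidHom.mem_ker] at hγ
  rw [cyclicSubgroup, Subgroup.mem_comap, hγ]
  exact one_mem _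

/-- The first homology group (written multiplicatively) of the `N`-fold cyclic covering, as the
abelianization of its fundamental group. -/
abbrev CyclicH1 (lk : G →* Multiplicative ℤ) (N : ℕ) := Abelianization (cyclicSubgroup lk N)

/-- The class of an element of `ker(lk)` in the first homology of the `N`-fold cyclic covering. -/
def kerToH1 (lk : G →* Multiplicative ℤ) (N : ℕ) : lk.ker →* CyclicH1 lk N :=
  Abelianization.of.comp (Subgroup.inclusion (ker_le_cyclicSubgroup lk N))

/-- `r : ker(lk) → H` is the metabelian homomorphism of the `N`-fold cyclic covering: `H` is the
torsion subgroup of the first homology, and `r` sends an element whose homology class is torsion to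
that class. -/
def IsMetabelian {lk : G →* Multiplicative ℤ} (N : ℕ) (r : lk.ker →* H) : Prop :=
  ∃ ι : H ≃* CommGroup.torsion (CyclicH1 lk N),
    ∀ γ : lk.ker, kerToH1 lk N γ ∈ CommGroup.torsion (CyclicH1 lk N) →
      (ι (r γ) : CyclicH1 lk N) = kerToH1 lk N γ

/-- The `N`-fold metabelian Alexander polynomial `det ∘ Υ_* (Δ_ρ^{K₁})` over the commutative ring
`A = ℚ[H]`, where `ρ` is induced by `r : ker(lk) → H`.  It is the class of a unit of `A_id((t))`
modulo `Aˣ`, or `0`. -/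
def metabelianPolynomial {H : Type*} [CommGroup H] {lk : G →* Multiplicative ℤ} {N : ℕ}
    (P : Presentation G g) (r : lk.ker →* H) {φ : MulAut H}
    (hm : lk P.meridian = Multiplicative.ofAdd 1) (hr : IsEquivariant r P.meridian φ)
    (hN : groupRingAut ℚ φ ^ N = 1) :
    WithZero (DetContainer (MonoidAlgebra ℚ H)) :=
  WithZero.map' ((QuotientGroup.mk' _).comp (detUpsilon hN)) (alexClass P (inducedRep ℚ r hm hr))

end Metafinite

/-! ## Knots, regular Seifert surfaces and the presentation of the knot group -/

section Topology

open unitInterval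

/-- The three-sphere, as the unit sphere of `ℝ⁴`. -/
abbrev S3 := Metric.sphere (0 : EuclideanSpace ℝ (Fin 4)) 1

/-- The complement of a subset of the three-sphere. -/
abbrev Compl (X : Set S3) := {p : S3 // p ∉ X}

/-- The class in the fundamental group of a loop. -/
def loopClass {X : Type*} [TopologicalSpace X] {b : X} (γ : Path b b) : FundamentalGroup X b :=
  FundamentalGroup.fromPath (Path.Homotopic.Quotient.mk γ)

/-- An (oriented, parametrised) embedded circle in the three-sphere. -/
structure Knot where
  curve : C(Circle, S3)
  injective : Function.Injective curve

namespace Knot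

variable (K : Knot)

/-- The knot as a subset of the three-sphere. -/
def image : Set S3 := Set.range K.curve

/-- A parametrised tubular neighbourhood `S¹ × D² ↪ S³` of the knot.  Its existence expresses that
the knot is tame; the orientation of `D²` fixes the direction of the meridians. -/
structure Tube where
  map : C(Circle × Metric.closedBall (0 : ℂ) 1, S3)
  injective : Function.Injective map
  core : ∀ s, map (s, ⟨0, by simp⟩) = K.curve s

end Knot

namespace Knot.Tube

variable {K : Knot} (T : K.Tube)

/-- The point `(s, exp(2πiθ))` of the boundary of the tubular neighbourhood. -/
def boundaryPoint (s : Circle) (θ : ℝ) : Compl K.image :=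
  ⟨T.map (s, ⟨Circle.exp (2 * Real.pi * θ),
    mem_closedBall_zero_iff.mpr (Circle.norm_coe _).le⟩), by
    rintro ⟨s', hs'⟩
    rw [← T.core] at hs'
    have := congrArg (fun q => (q.2 : ℂ)) (T.injective hs')
    exact Circle.coe_ne_zero _ this.symm⟩

theorem continuous_boundaryPoint (s : Circle) : Continuous (T.boundaryPoint s) := by
  refine Continuous.subtype_mk (T.map.continuous.comp (Continuous.prodMk continuous_const ?_)) _
  exact Continuous.subtype_mk (by fun_prop) _

/-- The meridian loop around the point `s` of the knot. -/
def meridianLoop (s : Circle) : Path (T.boundaryPoint s 0) (T.boundaryPoint s 0) where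
  toFun t := T.boundaryPoint s t
  continuous_toFun := (T.continuous_boundaryPoint s).comp continuous_subtype_val
  source' := rfl
  target' := by
    refine Subtype.ext (congrArg (fun w => T.map (s, w)) (Subtype.ext ?_))
    simp

/-- `m` is a meridian of the knot: the class of a loop that runs along some path to the boundary of
the tubular neighbourhood, then around the boundary of a fibre disc, and back along the path. -/
def IsMeridian (b : Compl K.image) (m : FundamentalGroup (Compl K.image) b) : Prop :=
  ∃ (s : Circle) (γ : Path b (T.boundaryPoint s 0)),
    m = loopClass ((γ.trans (T.meridianLoop s)).trans γ.symm)

end Knot.Tube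

/-- A Seifert surface of `K`: a compact connected surface in the three-sphere with boundary `K`,
together with a bicollar (so that the surface is two-sided, hence orientable, and its two sides are
named). -/
structure SeifertSurface (K : Knot) where
  carrier : Set S3
  isCompact : IsCompact carrier
  isConnected : IsConnected carrier
  image_subset : K.image ⊆ carrier
  chart : ∀ p : carrier, ∃ e : OpenPartialHomeomorph carrier (EuclideanHalfSpace 2),
    p ∈ e.source ∧ ((e p).1 0 = 0 ↔ (p : S3) ∈ K.image)
  collar : C(carrier × Set.Icc (-1 : ℝ) 1, S3)
  collar_injective : Function.Injective collar
  collar_zero : ∀ p : carrier, collar (p, ⟨0, by norm_num⟩) = p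

namespace SeifertSurface

variable {K : Knot} (F : SeifertSurface K)

/-- The push-off `p ↦ p × {t}`, `t ≠ 0`, from the surface to its complement. -/
def pushOff (t : Set.Icc (-1 : ℝ) 1) (ht : (t : ℝ) ≠ 0) : C(F.carrier, Compl F.carrier) where
  toFun p := ⟨F.collar (p, t), fun h => ht (by
    have := F.collar_injective (F.collar_zero ⟨_, h⟩)
    exact (congrArg (fun q => (q.2 : ℝ)) this).symm)⟩
  continuous_toFun := Continuous.subtype_mk (by fun_prop) _

/-- The push-off to the upper side. -/
def upper : C(F.carrier, Compl F.carrier) := F.pushOff ⟨1, by norm_num⟩ (by norm_num)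

/-- The push-off to the lower side. -/
def lower : C(F.carrier, Compl F.carrier) := F.pushOff ⟨-1, by norm_num⟩ (by norm_num)

/-- The inclusion of the complement of the surface into the complement of the knot. -/
def incl : C(Compl F.carrier, Compl K.image) where
  toFun p := ⟨p, fun h => p.2 (F.image_subset h)⟩
  continuous_toFun := Continuous.subtype_mk continuous_subtype_val _

/-- The point `(p, t)` of the collar, for an interior point `p` of the surface. -/
def collarPoint (p : F.carrier) (hp : (p : S3) ∉ K.image) (t : Set.Icc (-1 : ℝ) 1) :
    Compl K.image :=
  ⟨F.collar (p, t), fun h => hp (by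
    have h0 := F.collar_injective (F.collar_zero ⟨_, F.image_subset h⟩)
    have h1 : F.collar (p, t) = (p : S3) := congrArg (fun q => (q.1 : S3)) h0
    exact h1 ▸ h)⟩

theorem continuous_collarPoint (p : F.carrier) (hp : (p : S3) ∉ K.image) :
    Continuous (F.collarPoint p hp) :=
  Continuous.subtype_mk (F.collar.continuous.comp (Continuous.prodMk continuous_const
    continuous_id)) _

/-- The affine bijection `t ↦ 2t - 1` from `[0, 1]` to `[-1, 1]`. -/
def crossingParam : C(I, Set.Icc (-1 : ℝ) 1) where
  toFun t := ⟨2 * (t : ℝ) - 1, by linarith [t.2.1], by linarith [t.2.2]⟩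
  continuous_toFun := Continuous.subtype_mk (by fun_prop) _

/-- The path `{p} × [-1, 1]` that crosses the surface at an interior point `p`, from the lower to
the upper side. -/
def crossing (p : F.carrier) (hp : (p : S3) ∉ K.image) :
    Path (F.incl (F.lower p)) (F.incl (F.upper p)) where
  toFun t := F.collarPoint p hp (crossingParam t)
  continuous_toFun := (F.continuous_collarPoint p hp).comp crossingParam.continuous
  source' := by
    refine Subtype.ext (congrArg (fun w => F.collar (p, w)) (Subtype.ext ?_))
    simp [crossingParam]
  target' := by
    refine Subtype.ext (congrArg (fun w => F.collar (p, w)) (Subtype.ext ?_))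
    norm_num [crossingParam]

/-- A regular spine of the Seifert surface: a bouquet of circles `u₁, …, u_{2g}` in the interior of
the surface which is a (strong) deformation retract of the surface, and whose embedding in the
three-sphere is isotopic to the standard one.  The latter is expressed by a homeomorphism of the
three-sphere which carries the bouquet into an equatorial two-sphere. -/
structure RegularSpine (g : ℕ) where
  pt : F.carrier
  loop : Fin (2 * g) → Path pt pt
  /-- Each circle passes only once through the wedge point. -/
  loop_eq_pt : ∀ j s, loop j s = pt → s = 0 ∨ s = 1
  /-- Apart from the wedge point, the circles are simple and disjoint. -/
  loop_inj : ∀ i j s t, loop i s = loop j t → loop i s ≠ pt → i = j ∧ s = t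
  pt_notMem : (pt : S3) ∉ K.image
  loop_notMem : ∀ j s, (loop j s : S3) ∉ K.image
  retract : ∃ D : C(I × F.carrier, F.carrier),
    (∀ p, D (0, p) = p) ∧ (∀ p, D (1, p) ∈ insert pt (⋃ j, Set.range (loop j))) ∧
      ∀ t, ∀ p ∈ insert pt (⋃ j, Set.range (loop j)), D (t, p) = p
  regular : ∃ Φ : S3 ≃ₜ S3, ∀ p ∈ insert pt (⋃ j, Set.range (loop j)),
    (Φ p : EuclideanSpace ℝ (Fin 4)) 3 = 0

end SeifertSurface

/-- The choices from which the presentation `⟨x₁, …, x_{2g}, 𝔪 ∣ 𝔪 yⱼ 𝔪⁻¹ = zⱼ⟩` of the knot group is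
read off: a Seifert surface `F` with a regular spine, a base point in `S³ ∖ F`, paths in `S³ ∖ F`
from the base point to the upper and to the lower copy of the wedge point, such that the loop which
runs along the lower path, crosses `F`, and returns along the upper path is a meridian; and free
generators `x₁, …, x_{2g}` of `π₁(S³ ∖ F)`. -/
structure RegularSplitting {K : Knot} (T : K.Tube) (g : ℕ) where
  surface : SeifertSurface K
  spine : surface.RegularSpine g
  base : Compl surface.carrier
  up : Path base (surface.upper spine.pt)
  down : Path base (surface.lower spine.pt)
  isMeridian : T.IsMeridian (surface.incl base)
    (loopClass (((down.map surface.incl.continuous).trans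
      (surface.crossing spine.pt spine.pt_notMem)).trans (up.map surface.incl.continuous).symm))
  gen : Fin (2 * g) → Path base base
  bijective : Function.Bijective (FreeGroup.lift fun i => loopClass (gen i))

namespace RegularSplitting

variable {K : Knot} {T : K.Tube} {g : ℕ} (S : RegularSplitting T g)

/-- The base point, as a point of the complement of the knot. -/
def knotBase : Compl K.image := S.surface.incl S.base

/-- The meridian `𝔪`, at the original base point. -/
def meridian : FundamentalGroup (Compl K.image) S.knotBase :=
  loopClass (((S.down.map S.surface.incl.continuous).trans
    (S.surface.crossing S.spine.pt S.spine.pt_notMem)).trans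
      (S.up.map S.surface.incl.continuous).symm)

/-- The isomorphism of the free group on `x₁, …, x_{2g}` with `π₁(S³ ∖ F)`. -/
def words : FreeGroup (Fin (2 * g)) ≃* FundamentalGroup (Compl S.surface.carrier) S.base :=
  MulEquiv.ofBijective _ S.bijective

/-- The loop `u_j^♭` in `S³ ∖ F` parallel to `u_j` on the lower side. -/
def flat (j : Fin (2 * g)) : FundamentalGroup (Compl S.surface.carrier) S.base :=
  loopClass ((S.down.trans ((S.spine.loop j).map S.surface.lower.continuous)).trans S.down.symm)

/-- The loop `u_j^♯` in `S³ ∖ F` parallel to `u_j` on the upper side. -/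
def sharp (j : Fin (2 * g)) : FundamentalGroup (Compl S.surface.carrier) S.base :=
  loopClass ((S.up.trans ((S.spine.loop j).map S.surface.upper.continuous)).trans S.up.symm)

/-- The presentation of the knot group at the base point `b`, transported along a path `h` from the
original base point.  Two choices of `h` differ by a conjugation of `𝔪` and of all `xᵢ` by one element
of the knot group; the words `yⱼ` and `zⱼ` do not depend on `h`. -/
def pres {b : Compl K.image} (h : Path S.knotBase b) :
    Presentation (FundamentalGroup (Compl K.image) b) g where
  meridian := FundamentalGroup.fundamentalGroupMulEquivOfPath h S.meridian
  x i := FundamentalGroup.fundamentalGroupMulEquivOfPath h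
    (loopClass ((S.gen i).map S.surface.incl.continuous))
  y j := S.words.symm (S.flat j)
  z j := S.words.symm (S.sharp j)

end RegularSplitting

/-! ### Homeomorphisms of the three-sphere -/

/-- `Ψ` carries the tubular neighbourhood `T` to `T'`. -/
def Knot.Tube.IsImage (Ψ : S3 ≃ₜ S3) {K K' : Knot} (T : K.Tube) (T' : K'.Tube) : Prop :=
  ∀ q, T'.map q = Ψ (T.map q)

theorem Knot.Tube.IsImage.image_eq {Ψ : S3 ≃ₜ S3} {K K' : Knot} {T : K.Tube} {T' : K'.Tube}
    (h : Knot.Tube.IsImage Ψ T T') (p : S3) : Ψ p ∈ K'.image ↔ p ∈ K.image := by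
  have hc : ∀ s, K'.curve s = Ψ (K.curve s) := fun s => by rw [← T.core, ← T'.core, h]
  constructor
  · rintro ⟨s, hs⟩
    exact ⟨s, Ψ.injective (by rw [← hc, hs])⟩
  · rintro ⟨s, rfl⟩
    exact ⟨s, hc s⟩

/-- The map between the knot complements induced by `Ψ`. -/
def Knot.Tube.IsImage.compl {Ψ : S3 ≃ₜ S3} {K K' : Knot} {T : K.Tube} {T' : K'.Tube}
    (h : Knot.Tube.IsImage Ψ T T') : C(Compl K.image, Compl K'.image) where
  toFun p := ⟨Ψ p, fun hp => p.2 ((h.image_eq p).mp hp)⟩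
  continuous_toFun := Continuous.subtype_mk (Ψ.continuous.comp continuous_subtype_val) _

/-- `Ψ` carries all the data of the regular splitting `S` to those of `S'`. -/
structure RegularSplitting.IsImage (Ψ : S3 ≃ₜ S3) {K K' : Knot} {T : K.Tube} {T' : K'.Tube}
    {g : ℕ} (S : RegularSplitting T g) (S' : RegularSplitting T' g) : Prop where
  carrier : S'.surface.carrier = Ψ '' S.surface.carrier
  collar : ∀ (p : S.surface.carrier) (p' : S'.surface.carrier) (t : Set.Icc (-1 : ℝ) 1),
    (p' : S3) = Ψ p → S'.surface.collar (p', t) = Ψ (S.surface.collar (p, t))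
  pt : (S'.spine.pt : S3) = Ψ S.spine.pt
  loop : ∀ j t, (S'.spine.loop j t : S3) = Ψ (S.spine.loop j t)
  base : (S'.base : S3) = Ψ S.base
  up : ∀ t, (S'.up t : S3) = Ψ (S.up t)
  down : ∀ t, (S'.down t : S3) = Ψ (S.down t)
  gen : ∀ i t, (S'.gen i t : S3) = Ψ (S.gen i t)

end Topology

end KnotK1

end

/-! Two frames, or a frame of `K` and a frame of its image under `Ψ`, give presentations with the
same words `yⱼ`, `zⱼ`; the meridians and the `xᵢ` correspond up to simultaneous conjugation by one
group element `γ`. With `u = ρ(γ)` the new variable is therefore `c τ = u τ u⁻¹`. The substitution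
`τ' ↦ c τ` is a ring isomorphism (`substTau`) that turns `ρ'` back into `ρ`, so it carries the new
Jacobian matrix to the old one conjugated by the scalar matrix `u`, and `τ'` to a conjugate of `τ`.
Since `K₁` is abelian, conjugation is invisible and the two Alexander classes correspond
(`alexClass_substTau`).

It remains to compare `Υ'` with `Υ` composed with the substitution. Write `(c τ)ⁿ = cₙ τⁿ`. If `κᴺ =
id`, then `τᴺ` is central, hence `(c τ)ᴺ = u τᴺ u⁻¹ = τᴺ`, that is, `c_N = 1` (`twistCoeff_eq_one`).
This gives `κ'ᴺ = id` and makes `cₙ` periodic in `n` modulo `N`, and periodicity is exactly what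
makes the two versions of `Υ` conjugate by the diagonal matrix with entries `c_{N-i}`
(`upsilon_substTau`). The images under `𝓜 ∘ Υ_*` thus agree in `K₁(A_id((t)))` itself, before
anything is divided out (`moritaUpsilon_alexClass_eq`). Any quantity computed from them, such as a
determinant or a chosen representing unit, agrees as well.

For group rings, `c` is the group element `r(𝔪' 𝔪⁻¹)` and the two automorphisms of `H` differ by
conjugation with it. In the metabelian case `κᴺ = id` because `𝔪ᴺ` lies in the fundamental group of
the `N`-fold covering and so acts trivially on its homology. That frames yield all meridians follows
by sliding a meridian loop along the boundary torus. -/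

noncomputable section

namespace KnotK1

/-! ### Powers of `c τ` and the substitution `τ' ↦ c τ`. -/

section Twist

variable {A : Type*} [Ring A]

/-- Automorphisms of a ring act on its group of units. -/
def unitAut (A : Type*) [Ring A] : RingAut A →* MulAut Aˣ where
  toFun κ := Units.mapEquiv κ.toMulEquiv
  map_one' := rfl
  map_mul' _ _ := rfl

/-- Conjugation by a unit, as an automorphism of the ring. -/
def innerAut (A : Type*) [Ring A] : Aˣ →* RingAut A where
  toFun c :=
    { toFun := fun a => c * a * (c⁻¹ : Aˣ)
      invFun := fun a => (c⁻¹ : Aˣ) * a * c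
      left_inv := fun a => by simp [mul_assoc]
      right_inv := fun a => by simp [mul_assoc]
      map_mul' := fun a b => by simp [mul_assoc]
      map_add' := fun a b => by simp [mul_add, add_mul] }
  map_one' := by
    refine RingEquiv.ext fun a => ?_
    simp
  map_mul' c d := by
    refine RingEquiv.ext fun a => ?_
    simp [mul_assoc]

/-- The coefficient `cₙ` in `(c τ)ⁿ = cₙ τⁿ`. -/
def twistCoeff (κ : RingAut A) (c : Aˣ) (n : ℤ) : Aˣ :=
  ((⟨c, κ⟩ : Aˣ ⋊[unitAut A] RingAut A) ^ n).left

theorem twist_zpow_right (κ : RingAut A) (c : Aˣ) (n : ℤ) :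
    ((⟨c, κ⟩ : Aˣ ⋊[unitAut A] RingAut A) ^ n).right = κ ^ n :=
  map_zpow (SemidirectProduct.rightHom (φ := unitAut A)) _ n

theorem twistCoeff_zero (κ : RingAut A) (c : Aˣ) : twistCoeff κ c 0 = 1 := by
  simp [twistCoeff]

theorem twistCoeff_one (κ : RingAut A) (c : Aˣ) : twistCoeff κ c 1 = c := by
  simp [twistCoeff]

theorem twistCoeff_add (κ : RingAut A) (c : Aˣ) (m n : ℤ) :
    (twistCoeff κ c (m + n) : A) = twistCoeff κ c m * (κ ^ m) (twistCoeff κ c n : A) := by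
  rw [twistCoeff, zpow_add, SemidirectProduct.mul_left, twist_zpow_right]
  rfl

theorem zpow_of_twist {κ κ' : RingAut A} {c : Aˣ} (hc : ∀ a, κ' a = c * κ a * (c⁻¹ : Aˣ)) (n : ℤ)
    (a : A) : (κ' ^ n) a = twistCoeff κ c n * (κ ^ n) a * ((twistCoeff κ c n)⁻¹ : Aˣ) := by
  -- The map `(c, κ) ↦ (conjugation by c) ∘ κ` is a homomorphism on the semidirect product, so the
  -- formula for `κ' = L (c, κ)` passes to all powers at once.
  let L : Aˣ ⋊[unitAut A] RingAut A →* RingAut A :=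
    SemidirectProduct.lift (innerAut A) (MonoidHom.id _) (fun κ => by
      refine MonoidHom.ext fun c => RingEquiv.ext fun a => ?_
      change (κ c : A) * a * κ (c⁻¹ : Aˣ) = κ (c * κ⁻¹ a * (c⁻¹ : Aˣ))
      rw [map_mul, map_mul, show κ (κ⁻¹ a) = a from RingEquiv.apply_symm_apply κ a])
  have hL : ∀ p, L p = innerAut A p.left * p.right := fun p => rfl
  have h1 : κ' = L ⟨c, κ⟩ := RingEquiv.ext hc
  rw [h1, ← map_zpow, hL, twist_zpow_right]
  rfl

namespace SkewLaurent

variable {κ κ' : RingAut A} {c : Aˣ}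

theorem C_apply (a : A) : C κ a = monomial 0 a := rfl

theorem coeff_C_mul (a : A) (f : SkewLaurent κ) (n : ℤ) : (C κ a * f).coeff n = a * f.coeff n := by
  rw [C_apply, coeff_monomial_mul]
  simp

theorem coeff_mul_C (a : A) (f : SkewLaurent κ) (n : ℤ) :
    (f * C κ a).coeff n = f.coeff n * (κ ^ n) a := by
  rw [C_apply, coeff_mul_monomial]
  simp

/-- The unit `c τ`. -/
def twistTau (κ : RingAut A) (c : Aˣ) : (SkewLaurent κ)ˣ :=
  Units.map (C κ).toMonoidHom c * tau κ

theorem val_twistTau : (twistTau κ c : SkewLaurent κ) = C κ c * tau κ := rfl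

theorem C_mul_tau (a : A) : (C κ a * tau κ : SkewLaurent κ) = monomial 1 a := by
  change (monomial 0 a * monomial 1 1 : SkewLaurent κ) = _
  rw [monomial_mul_monomial]
  simp

/-- The cocycle identity `twistCoeff_add` makes `n ↦ cₙ τⁿ` a homomorphism from `ℤ` to the units. It
takes the value `c τ` at `1`, so it is the power map of `c τ`, also for negative exponents. -/
theorem val_twistTau_zpow (n : ℤ) :
    ((twistTau κ c ^ n : (SkewLaurent κ)ˣ) : SkewLaurent κ) = monomial n (twistCoeff κ c n : A) := by
  have hmul : ∀ m n : ℤ, (monomial m (twistCoeff κ c m : A) * monomial n (twistCoeff κ c n : A) :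
      SkewLaurent κ) = monomial (m + n) (twistCoeff κ c (m + n) : A) := fun m n => by
    rw [monomial_mul_monomial, twistCoeff_add]
  have h0 : (monomial 0 (twistCoeff κ c 0 : A) : SkewLaurent κ) = 1 := by
    rw [twistCoeff_zero]
    rfl
  let w : Multiplicative ℤ →* (SkewLaurent κ)ˣ :=
    { toFun := fun n => ⟨monomial n.toAdd (twistCoeff κ c n.toAdd : A),
        monomial (-n.toAdd) (twistCoeff κ c (-n.toAdd) : A), by
          rw [hmul, add_neg_cancel, h0], by rw [hmul, neg_add_cancel, h0]⟩
      map_one' := Units.ext h0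
      map_mul' := fun m n => Units.ext (hmul m.toAdd n.toAdd).symm }
  have h1 : w (Multiplicative.ofAdd 1) = twistTau κ c := by
    refine Units.ext ?_
    rw [val_twistTau, C_mul_tau]
    change monomial 1 (twistCoeff κ c 1 : A) = _
    rw [twistCoeff_one]
  rw [← h1, ← map_zpow, ← ofAdd_zsmul]
  change monomial (n • (1 : ℤ)) (twistCoeff κ c (n • (1 : ℤ)) : A) = _
  simp

theorem monomial_injective (n : ℤ) {a b : A} (h : (monomial n a : SkewLaurent κ) = monomial n b) :
    a = b := by
  have := congrArg (fun f => f.coeff n) h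
  simpa [coeff_monomial] using this

theorem val_tau_zpow (n : ℤ) : ((tau κ ^ n : (SkewLaurent κ)ˣ) : SkewLaurent κ) = monomial n 1 := by
  have h1 : tau κ = twistTau κ 1 := by simp [twistTau]
  have h2 : ∀ n, twistCoeff κ 1 n = 1 := fun n => by
    have : (⟨1, κ⟩ : Aˣ ⋊[unitAut A] RingAut A) = SemidirectProduct.inr κ := rfl
    rw [twistCoeff, this, ← map_zpow]
    rfl
  rw [h1, val_twistTau_zpow, h2]
  rfl

/-- Moving `τᴺ` past a coefficient applies `κᴺ = id`. This centrality is the one place where finite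
order enters the comparison of conjugate meridians. -/
theorem tau_pow_commute {N : ℕ} (h : κ ^ N = 1) (f : SkewLaurent κ) :
    Commute ((tau κ : SkewLaurent κ) ^ N) f := by
  have e : (tau κ : SkewLaurent κ) ^ N = monomial N 1 := by
    rw [← val_tau_zpow, zpow_natCast, Units.val_pow_eq_pow_val]
  ext n
  rw [e, coeff_monomial_mul, coeff_mul_monomial, zpow_natCast, h]
  simp

/-- If `c τ` is conjugate to `τ`, then the `N`-th power of `c τ` is `τᴺ`. -/
theorem twistCoeff_eq_one {N : ℕ} (h : κ ^ N = 1) {u : (SkewLaurent κ)ˣ}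
    (hu : twistTau κ c = u * tau κ * u⁻¹) : twistCoeff κ c N = 1 := by
  have h1 : twistTau κ c ^ N = tau κ ^ N := by
    -- The conjugate `u τᴺ u⁻¹` collapses to `τᴺ` by centrality.
    rw [hu, conj_pow]
    refine Units.ext ?_
    rw [Units.val_mul, Units.val_mul, Units.val_pow_eq_pow_val, ← (tau_pow_commute h _).eq,
      mul_assoc, Units.mul_inv, mul_one]
  have h2 : (monomial N (twistCoeff κ c N : A) : SkewLaurent κ) = monomial N 1 := by
    rw [← val_twistTau_zpow, ← val_tau_zpow, zpow_natCast, zpow_natCast, h1]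
  exact Units.ext (monomial_injective _ h2)

theorem pow_eq_one_of_twist {N : ℕ} (hc : ∀ a, κ' a = c * κ a * (c⁻¹ : Aˣ)) (h : κ ^ N = 1)
    (hN : twistCoeff κ c N = 1) : κ' ^ N = 1 := by
  refine RingEquiv.ext fun a => ?_
  have := zpow_of_twist hc N a
  rw [hN, zpow_natCast, zpow_natCast, h] at this
  simpa using this

/-- The two hypotheses say that `(c, κ)ᴺ = 1` in the semidirect product, so its powers depend only
on the exponent modulo `N`. -/
theorem twistCoeff_of_dvd {N : ℕ} (h : κ ^ N = 1) (hN : twistCoeff κ c N = 1) {a b : ℤ}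
    (hab : (N : ℤ) ∣ a - b) : twistCoeff κ c a = twistCoeff κ c b := by
  have hg : (⟨c, κ⟩ : Aˣ ⋊[unitAut A] RingAut A) ^ (N : ℤ) = 1 :=
    SemidirectProduct.ext hN (by rw [twist_zpow_right, zpow_natCast, h]; rfl)
  obtain ⟨k, hk⟩ := hab
  have : a = N * k + b := by omega
  rw [twistCoeff, this, zpow_add, zpow_mul, hg, one_zpow, one_mul]
  rfl

/-- The substitution `τ' ↦ c τ`, an isomorphism `A_κ'((τ')) ≅ A_κ((τ))` if `κ' = c κ c⁻¹`. -/
def substTau (hc : ∀ a, κ' a = c * κ a * (c⁻¹ : Aˣ)) : SkewLaurent κ' ≃+* SkewLaurent κ where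
  toFun f :=
    { coeff := fun n => f.coeff n * twistCoeff κ c n
      bounded := by
        obtain ⟨m, hm⟩ := f.bounded
        exact ⟨m, fun n hn => by rw [hm n hn, zero_mul]⟩ }
  invFun f :=
    { coeff := fun n => f.coeff n * ((twistCoeff κ c n)⁻¹ : Aˣ)
      bounded := by
        obtain ⟨m, hm⟩ := f.bounded
        exact ⟨m, fun n hn => by rw [hm n hn, zero_mul]⟩ }
  left_inv f := by
    ext n
    simp
  right_inv f := by
    ext n
    simp
  map_add' f g := by
    ext n
    simp [add_mul]
  map_mul' f g := by
    ext n
    obtain ⟨a, ha⟩ := f.bounded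
    obtain ⟨b, hb⟩ := g.bounded
    rw [coeff_mul (a := a) (b := n - b) n (fun i hi => by simp [ha i hi])
      (fun i hi => by simp [hb (n - i) (by omega)])]
    change (f * g).coeff n * _ = _
    rw [coeff_mul (a := a) (b := n - b) n ha (fun i hi => hb _ (by omega)), Finset.sum_mul]
    refine Finset.sum_congr rfl fun i _ => ?_
    have e : twistCoeff κ c n = twistCoeff κ c (i + (n - i)) := by rw [add_sub_cancel]
    rw [zpow_of_twist hc, e, twistCoeff_add, map_mul]
    simp [mul_assoc]

/-- The substitution `τ' ↦ c τ` as a ring homomorphism. -/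
def substTauHom (hc : ∀ a, κ' a = c * κ a * (c⁻¹ : Aˣ)) : SkewLaurent κ' →+* SkewLaurent κ :=
  (substTau hc).toRingHom

theorem coeff_substTau (hc : ∀ a, κ' a = c * κ a * (c⁻¹ : Aˣ)) (f : SkewLaurent κ') (n : ℤ) :
    (substTau hc f).coeff n = f.coeff n * twistCoeff κ c n := rfl

theorem substTau_monomial (hc : ∀ a, κ' a = c * κ a * (c⁻¹ : Aˣ)) (n : ℤ) (a : A) :
    substTau hc (monomial n a) = monomial n (a * twistCoeff κ c n) := by
  ext k
  rw [coeff_substTau, coeff_monomial, coeff_monomial]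
  split_ifs with h
  · rw [h]
  · rw [zero_mul]

theorem substTau_tau (hc : ∀ a, κ' a = c * κ a * (c⁻¹ : Aˣ)) :
    substTau hc (tau κ') = twistTau κ c := by
  change substTau hc (monomial 1 1) = _
  rw [substTau_monomial, one_mul, twistCoeff_one, val_twistTau, C_mul_tau]

end SkewLaurent

end Twist

/-! ### Comparison of `Υ` for `τ` and for `c τ`. -/

section UpsilonTwist

open SkewLaurent

variable {A : Type*} [Ring A] {κ κ' : RingAut A} {c : Aˣ} {N : ℕ}

/-- The invertible diagonal matrix that compares `Υ` for `τ` and for `c τ`. -/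
def twistDiagonal (κ : RingAut A) (c : Aˣ) (N : ℕ) :
    (Matrix (Fin N) (Fin N) (SkewLaurent (1 : RingAut A)))ˣ :=
  Units.map (Matrix.diagonalRingHom (Fin N) (SkewLaurent (1 : RingAut A))).toMonoidHom
    (MulEquiv.piUnits.symm fun i : Fin N =>
      Units.map (C (1 : RingAut A)).toMonoidHom (twistCoeff κ c ((N : ℤ) - i)))

/-- In entry `(i, j)` and degree `n` with `j ≡ i - n`, the left side is `c_{N-i} κ^{N-i}(fₙ)
c_{N-i}⁻¹` and the right side is `c_{N-i} κ^{N-i}(fₙ cₙ) c_{N-j}⁻¹`. They agree because `c_{N-i}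
κ^{N-i}(cₙ) = c_{N-i+n} = c_{N-j}`, the last step by periodicity. -/
theorem upsilon_substTau (hc : ∀ a, κ' a = c * κ a * (c⁻¹ : Aˣ)) (h : κ ^ N = 1)
    (h' : κ' ^ N = 1) (hN : twistCoeff κ c N = 1) (f : SkewLaurent κ') :
    upsilon h' f = twistDiagonal κ c N * upsilon h (substTau hc f) *
      ((twistDiagonal κ c N)⁻¹ : (Matrix (Fin N) (Fin N) (SkewLaurent (1 : RingAut A)))ˣ) := by
  ext i j n
  change (upsilonFun κ' N f i j).coeff n = ((Matrix.diagonal (fun i : Fin N =>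
    C 1 (twistCoeff κ c ((N : ℤ) - i) : A)) * upsilonFun κ N (substTau hc f) *
      Matrix.diagonal (fun i : Fin N =>
        C 1 (((twistCoeff κ c ((N : ℤ) - i))⁻¹ : Aˣ) : A))) i j).coeff n
  rw [Matrix.mul_diagonal, Matrix.diagonal_mul, coeff_mul_C, coeff_C_mul, upsilonFun_coeff,
    upsilonFun_coeff, coeff_substTau, one_zpow]
  split_ifs with hd
  · have hi : ((N - (i : ℕ) : ℕ) : ℤ) = (N : ℤ) - i := by
      have := i.2
      omega
    have e := twistCoeff_add κ c ((N : ℤ) - i) n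
    -- Here the nonvanishing condition on the entry is turned into the congruence `N - i + n ≡ N -
    -- j`.
    rw [twistCoeff_of_dvd h hN (b := (N : ℤ) - j) (by
      have : (N : ℤ) - i + n - (N - j) = -((i : ℤ) - j - n) := by ring
      rw [this]
      exact (dvd_neg).mpr hd)] at e
    rw [← zpow_natCast, ← zpow_natCast, hi, zpow_of_twist hc, map_mul]
    rw [← mul_assoc, mul_assoc _ ((κ ^ ((N : ℤ) - i)) (twistCoeff κ c n : A)), RingAut.one_apply]
    have e2 : (κ ^ ((N : ℤ) - i)) (twistCoeff κ c n : A) =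
        ((twistCoeff κ c ((N : ℤ) - i))⁻¹ : Aˣ) * (twistCoeff κ c ((N : ℤ) - j) : A) := by
      rw [e, Units.inv_mul_cancel_left]
    rw [e2]
    simp [mul_assoc]
  · simp

end UpsilonTwist

/-! ### Functoriality of `K₁` and its invariance under inner automorphisms. -/

section KOneConj

variable {R S : Type*} [Ring R] [Ring S]

/-- Ring homomorphisms that differ by an inner automorphism induce the same map on `K₁`. -/
theorem K1.map_eq_of_conj {f₁ f₂ : R →+* S} (u : Sˣ)
    (h : ∀ x, f₂ x = u * f₁ x * (u⁻¹ : Sˣ)) : K1.map f₂ = K1.map f₁ := by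
  refine K1.hom_ext fun n M => ?_
  rw [K1.map_mk, K1.map_mk]
  have : Units.map f₂.mapMatrix.toMonoidHom M =
      Units.map (Matrix.scalar (Fin n)).toMonoidHom u * Units.map f₁.mapMatrix.toMonoidHom M *
        (Units.map (Matrix.scalar (Fin n)).toMonoidHom u)⁻¹ := by
    ext i j
    change f₂ (M.1 i j) = (Matrix.diagonal (fun _ : Fin n => (u : S)) * f₁.mapMatrix M.1 *
      Matrix.diagonal (fun _ : Fin n => ((u⁻¹ : Sˣ) : S))) i j
    rw [Matrix.mul_diagonal, Matrix.diagonal_mul, h]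
    rfl
  rw [this, map_mul, map_mul, map_inv, mul_inv_cancel_comm]

theorem K1.map_comp {Q : Type*} [Ring Q] (f : S →+* Q) (e : R →+* S) (k : K1 R) :
    K1.map f (K1.map e k) = K1.map (f.comp e) k := by
  have : (K1.map f).comp (K1.map e) = K1.map (f.comp e) := by
    refine K1.hom_ext fun n M => ?_
    rfl
  exact DFunLike.congr_fun this k

theorem K1.map_unit (f : R →+* S) (u : Rˣ) :
    K1.map f (K1.unit u) = K1.unit (Units.map f.toMonoidHom u) := by
  change K1.map f (K1.mk 1 _) = K1.mk 1 _
  rw [K1.map_mk]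
  congr 1
  ext i j
  change f (Matrix.diagonal (fun _ => (u : R)) i j) = Matrix.diagonal (fun _ => f u) i j
  rw [Matrix.diagonal_apply, Matrix.diagonal_apply]
  split_ifs <;> simp

end KOneConj

/-! ### The Alexander class under a change of variable. -/

section AlexanderTwist

open SkewLaurent

variable {A : Type*} [Ring A] {κ κ' : RingAut A} {c : Aˣ} {G G' : Type*} [Group G] [Group G']
  {g : ℕ}

theorem moritaUpsilon_substTau {N : ℕ} (hc : ∀ a, κ' a = c * κ a * (c⁻¹ : Aˣ)) (h : κ ^ N = 1)
    (h' : κ' ^ N = 1) (hN : twistCoeff κ c N = 1) (k : K1 (SkewLaurent κ')) :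
    moritaUpsilon h (K1.map (substTauHom hc) k) =
      moritaUpsilon h' k := by
  rw [moritaUpsilon, moritaUpsilon, MonoidHom.comp_apply, MonoidHom.comp_apply, K1.map_comp,
    K1.map_eq_of_conj (f₁ := (upsilon h).comp (substTauHom hc))
      (f₂ := upsilon h') (twistDiagonal κ c N) (fun f => upsilon_substTau hc h h' hN f)]

variable {P : Presentation G g} {P' : Presentation G' g} {ρ : IntGroupRing G →+* SkewLaurent κ}
  {ρ' : IntGroupRing G' →+* SkewLaurent κ'}

theorem evalWords_of (w : FreeGroup (Fin (2 * g))) :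
    evalWords P ρ (MonoidAlgebra.of ℤ _ w) = ρ (MonoidAlgebra.of ℤ G (FreeGroup.lift P.x w)) := by
  simp [evalWords]

/-- Both sides are ring homomorphisms of `a`, so the hypothesis on the generators `xᵢ` suffices. -/
theorem evalWords_substTau (hc : ∀ a, κ' a = c * κ a * (c⁻¹ : Aˣ)) (u : (SkewLaurent κ)ˣ)
    (hx : ∀ i, substTau hc (ρ' (MonoidAlgebra.of ℤ G' (P'.x i))) =
      u * ρ (MonoidAlgebra.of ℤ G (P.x i)) * (u⁻¹ : (SkewLaurent κ)ˣ))
    (a : IntGroupRing (FreeGroup (Fin (2 * g)))) :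
    substTau hc (evalWords P' ρ' a) = u * evalWords P ρ a * (u⁻¹ : (SkewLaurent κ)ˣ) := by
  let f₁ := (substTauHom hc).comp (evalWords P' ρ')
  let f₂ := (innerAut (SkewLaurent κ) u : SkewLaurent κ →+* SkewLaurent κ).comp (evalWords P ρ)
  -- The target is only a multiplicative monoid; passing to units makes the universal property of
  -- the free group applicable.
  have hu : (f₁.toMonoidHom.comp (MonoidAlgebra.of ℤ _)).toHomUnits =
      (f₂.toMonoidHom.comp (MonoidAlgebra.of ℤ _)).toHomUnits := by
    refine FreeGroup.ext_hom _ _ fun i => Units.ext ?_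
    change substTau hc (evalWords P' ρ' (MonoidAlgebra.of ℤ _ (FreeGroup.of i))) =
      u * evalWords P ρ (MonoidAlgebra.of ℤ _ (FreeGroup.of i)) * (u⁻¹ : (SkewLaurent κ)ˣ)
    rw [evalWords_of, evalWords_of, FreeGroup.lift_apply_of, FreeGroup.lift_apply_of, hx]
  have key : f₁ = f₂ := MonoidAlgebra.ringHom_ext' (RingHom.ext_int _ _)
    (MonoidHom.ext fun w => congrArg Units.val (DFunLike.congr_fun hu w))
  exact DFunLike.congr_fun key a

theorem alexMatrix_substTau
    (hc : ∀ a, κ' a = c * κ a * (c⁻¹ : Aˣ)) {u : (SkewLaurent κ)ˣ}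
    (hu : twistTau κ c = u * tau κ * u⁻¹)
    (hx : ∀ i, substTau hc (ρ' (MonoidAlgebra.of ℤ G' (P'.x i))) =
      u * ρ (MonoidAlgebra.of ℤ G (P.x i)) * (u⁻¹ : (SkewLaurent κ)ˣ))
    (hy : P'.y = P.y) (hz : P'.z = P.z) :
    (substTauHom hc).mapMatrix (alexMatrix P' ρ') =
      (Units.map (Matrix.scalar (Fin (2 * g))).toMonoidHom u : GLn (SkewLaurent κ) (2 * g)) *
        alexMatrix P ρ * ((Units.map (Matrix.scalar (Fin (2 * g))).toMonoidHom u)⁻¹ :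
          GLn (SkewLaurent κ) (2 * g)) := by
  ext1 j i
  change substTau hc (tau κ' * evalWords P' ρ' (foxDeriv i (P'.y j)) -
      evalWords P' ρ' (foxDeriv i (P'.z j))) =
    ((Matrix.diagonal (fun _ => (u : SkewLaurent κ)) * alexMatrix P ρ *
      Matrix.diagonal (fun _ => ((u⁻¹ : (SkewLaurent κ)ˣ) : SkewLaurent κ)) :
        Matrix (Fin (2 * g)) (Fin (2 * g)) (SkewLaurent κ))) j i
  rw [Matrix.mul_diagonal, Matrix.diagonal_mul, map_sub, map_mul, substTau_tau,
    evalWords_substTau hc u hx, evalWords_substTau hc u hx, hu, hy, hz]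
  simp [alexMatrix, mul_sub, sub_mul, mul_assoc]

/-- The matrix and the factor `τ` are both replaced by conjugates, which have the same class. The
identity holds in `K₁` itself, and the vanishing case is preserved because conjugation and the ring
isomorphism respect invertibility. -/
theorem alexClass_substTau
    (hc : ∀ a, κ' a = c * κ a * (c⁻¹ : Aˣ)) {u : (SkewLaurent κ)ˣ}
    (hu : twistTau κ c = u * tau κ * u⁻¹)
    (hx : ∀ i, substTau hc (ρ' (MonoidAlgebra.of ℤ G' (P'.x i))) =
      u * ρ (MonoidAlgebra.of ℤ G (P.x i)) * (u⁻¹ : (SkewLaurent κ)ˣ))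
    (hy : P'.y = P.y) (hz : P'.z = P.z) :
    WithZero.map' (K1.map (substTauHom hc)) (alexClass P' ρ') =
      alexClass P ρ := by
  have hmat := alexMatrix_substTau hc hu hx hy hz
  set θ := substTauHom hc
  have hunit : IsUnit (alexMatrix P' ρ') ↔ IsUnit (alexMatrix P ρ) := by
    rw [← MulEquiv.isUnit_map (RingEquiv.mapMatrix (m := Fin (2 * g)) (substTau hc))]
    change IsUnit (θ.mapMatrix (alexMatrix P' ρ')) ↔ _
    rw [hmat, Units.isUnit_mul_units, Units.isUnit_units_mul]
  by_cases h : IsUnit (alexMatrix P ρ)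
  · have h' := hunit.mpr h
    rw [alexClass, alexClass, dif_pos h, dif_pos h', WithZero.map'_coe]
    congr 1
    have h1 : K1.map θ (K1.unit (tau κ')) = K1.unit (tau κ) := by
      have : Units.map θ.toMonoidHom (tau κ') = u * tau κ * u⁻¹ := by
        rw [← hu]
        exact Units.ext (substTau_tau hc)
      rw [K1.map_unit, this, map_mul, map_mul, map_inv, mul_inv_cancel_comm]
    have h2 : Units.map θ.mapMatrix.toMonoidHom h'.unit =
        Units.map (Matrix.scalar (Fin (2 * g))).toMonoidHom u * h.unit *
          (Units.map (Matrix.scalar (Fin (2 * g))).toMonoidHom u)⁻¹ := Units.ext hmat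
    rw [map_mul, map_zpow, h1, K1.map_mk, h2, map_mul, map_mul, map_inv, mul_inv_cancel_comm]
  · rw [alexClass, alexClass, dif_neg h, dif_neg (fun h' => h (hunit.mp h')), map_zero]

/-- Replacing `τ` by the conjugate `c τ` does not change the image of the Alexander class under
`𝓜 ∘ Υ_*`. -/
theorem moritaUpsilon_alexClass_eq
    (hc : ∀ a, κ' a = c * κ a * (c⁻¹ : Aˣ)) {u : (SkewLaurent κ)ˣ}
    (hu : twistTau κ c = u * tau κ * u⁻¹)
    (hx : ∀ i, substTau hc (ρ' (MonoidAlgebra.of ℤ G' (P'.x i))) =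
      u * ρ (MonoidAlgebra.of ℤ G (P.x i)) * (u⁻¹ : (SkewLaurent κ)ˣ))
    (hy : P'.y = P.y) (hz : P'.z = P.z)
    {N N' : ℕ} (hNN : N = N') (h : κ ^ N = 1) (h' : κ' ^ N' = 1) :
    WithZero.map' (moritaUpsilon h) (alexClass P ρ) =
      WithZero.map' (moritaUpsilon h') (alexClass P' ρ') := by
  subst hNN
  -- The equality `N = N'` is a separate hypothesis so that the two orders of automorphisms can be
  -- inserted, which are equal but not definitionally.
  rw [← alexClass_substTau hc hu hx hy hz]
  rcases alexClass P' ρ' with _ | k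
  · rfl
  · exact congrArg WithZero.coe
      (moritaUpsilon_substTau hc h h' (twistCoeff_eq_one h hu) k)

/-- The converse reverses the roles: `(c τ)ᴺ` is the image of the central element `τ'ᴺ`, and `τᴺ` is
conjugate to it. Hence `τᴺ` is central, which forces `κᴺ = id`. Equality of the orders of `κ` and
`κ'` rests on this. -/
theorem pow_eq_one_iff_of_twist (hc : ∀ a, κ' a = c * κ a * (c⁻¹ : Aˣ)) {u : (SkewLaurent κ)ˣ}
    (hu : twistTau κ c = u * tau κ * u⁻¹) (N : ℕ) : κ ^ N = 1 ↔ κ' ^ N = 1 := by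
  refine ⟨fun h => pow_eq_one_of_twist hc h (twistCoeff_eq_one h hu), fun h' => ?_⟩
  have hcomm : ∀ f : SkewLaurent κ, Commute ((twistTau κ c : SkewLaurent κ) ^ N) f := fun f => by
    have := (tau_pow_commute h' ((substTau hc).symm f)).map (substTau hc)
    rwa [map_pow, substTau_tau, RingEquiv.apply_symm_apply] at this
  have h1 : twistTau κ c ^ N = tau κ ^ N := by
    have e : tau κ = u⁻¹ * twistTau κ c * u⁻¹⁻¹ := by
      rw [hu]
      group
    rw [e, conj_pow]
    refine Units.ext ?_
    rw [Units.val_mul, Units.val_mul, Units.val_pow_eq_pow_val, ← (hcomm _).eq,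
      mul_assoc, Units.mul_inv, mul_one]
  have h2 : (twistTau κ c : SkewLaurent κ) ^ N = monomial N 1 := by
    rw [← val_tau_zpow, zpow_natCast, ← h1, Units.val_pow_eq_pow_val]
  refine RingEquiv.ext fun a => ?_
  -- Comparing the coefficients of `τᴺ` in `τᴺ a = a τᴺ` gives `κᴺ(a) = a`.
  have := congrArg (fun f => f.coeff N) (hcomm (C κ a)).eq
  simp only [h2, coeff_C_mul, coeff_mul_C, coeff_monomial] at this
  simpa using this

end AlexanderTwist

/-! ### Change of base point and free homotopies in fundamental groups. -/

section FundamentalGroupLemmas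

variable {X Y Z : Type*} [TopologicalSpace X] [TopologicalSpace Y] [TopologicalSpace Z]

theorem exists_loopClass {b : X} (γ : FundamentalGroup X b) : ∃ p : Path b b, γ = loopClass p := by
  obtain ⟨p, hp⟩ := Path.Homotopic.Quotient.mk_surjective γ
  exact ⟨p, hp.symm⟩

theorem quotient_map_trans (f : C(X, Y)) {a b c : X} (p : Path.Homotopic.Quotient a b)
    (q : Path.Homotopic.Quotient b c) : (p.trans q).map f = (p.map f).trans (q.map f) :=
  (FundamentalGroupoid.map f).map_comp (X := ⟨a⟩) (Y := ⟨b⟩) (Z := ⟨c⟩) p q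

theorem transport_eq {a b : X} (h : Path a b) (x : FundamentalGroup X a) :
    FundamentalGroup.fundamentalGroupMulEquivOfPath h x =
      FundamentalGroup.fromPath ((Path.Homotopic.Quotient.mk h).symm.trans
        ((FundamentalGroup.toPath x).trans (Path.Homotopic.Quotient.mk h))) := rfl

/-- Transports along two paths with the same ends differ by a conjugation. -/
theorem transport_eq_conj {a b : X} (h h' : Path a b) :
    ∃ γ : FundamentalGroup X b, ∀ x, FundamentalGroup.fundamentalGroupMulEquivOfPath h' x =
      γ * FundamentalGroup.fundamentalGroupMulEquivOfPath h x * γ⁻¹ := by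
  -- The conjugating loop is `h⁻¹` followed by `h'`. Products in the fundamental group compose paths
  -- from right to left, so this loop itself, not its inverse, stands on the left.
  refine ⟨FundamentalGroup.fromPath
    ((Path.Homotopic.Quotient.mk h).symm.trans (Path.Homotopic.Quotient.mk h')), fun x => ?_⟩
  rw [← mul_inv_eq_iff_eq_mul, inv_inv]
  simp only [transport_eq, FundamentalGroup.mul_def]
  simp only [← Path.Homotopic.Quotient.trans_assoc]
  simp only [Path.Homotopic.Quotient.trans_assoc, Path.Homotopic.Quotient.trans_symm,
    Path.Homotopic.Quotient.trans_refl]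

theorem transport_loopClass {a b c : X} (h : Path a b) (γ : Path a c) (μ : Path c c) :
    FundamentalGroup.fundamentalGroupMulEquivOfPath h
      (loopClass ((γ.trans μ).trans γ.symm)) =
      loopClass (((h.symm.trans γ).trans μ).trans (h.symm.trans γ).symm) := by
  rw [transport_eq]
  simp [loopClass, Path.Homotopic.Quotient.mk_trans, Path.Homotopic.Quotient.mk_symm,
    Path.trans_symm]

/-- Transport along `γ₀ δ γ⁻¹` cancels `γ₀`, conjugates `μ` by `δ` to `ν`, and reattaches `ν` along
`γ`. This supplies the frame that realises a prescribed meridian. -/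
theorem transport_loopClass_of_conj {a b c d : X} (γ₀ : Path a c) {μ : Path c c} {δ : Path c d}
    {ν : Path d d} (γ : Path b d)
    (h : (Path.Homotopic.Quotient.mk δ).symm.trans ((Path.Homotopic.Quotient.mk μ).trans
      (Path.Homotopic.Quotient.mk δ)) = Path.Homotopic.Quotient.mk ν) :
    FundamentalGroup.fundamentalGroupMulEquivOfPath ((γ₀.trans δ).trans γ.symm)
      (loopClass ((γ₀.trans μ).trans γ₀.symm)) = loopClass ((γ.trans ν).trans γ.symm) := by
  have hs : ∀ {x y z : X} (p : Path.Homotopic.Quotient x y) (q : Path.Homotopic.Quotient y z),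
      p.symm.trans (p.trans q) = q := fun p q => by
    rw [← Path.Homotopic.Quotient.trans_assoc, Path.Homotopic.Quotient.symm_trans,
      Path.Homotopic.Quotient.refl_trans]
  rw [transport_eq, ← Path.Homotopic.Quotient.mk_symm, Path.trans_symm, Path.trans_symm,
    Path.symm_symm]
  simp only [loopClass, Path.Homotopic.Quotient.mk_trans, Path.Homotopic.Quotient.mk_symm,
    Path.Homotopic.Quotient.trans_assoc, ← h, hs]

/-- On a product, a loop in the second factor is freely homotopic to its translates along paths in
the first factor. -/
theorem loop_conj_of_prod (f : C(X × Y, Z)) {a b : X} {y : Y} (σ : Path a b) (l : Path y y) :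
    ((Path.Homotopic.Quotient.mk ((σ.prod (Path.refl y)).map f.continuous)).symm.trans
      ((Path.Homotopic.Quotient.mk (((Path.refl a).prod l).map f.continuous)).trans
        (Path.Homotopic.Quotient.mk ((σ.prod (Path.refl y)).map f.continuous)))) =
      Path.Homotopic.Quotient.mk (((Path.refl b).prod l).map f.continuous) := by
  have key : (Path.Homotopic.Quotient.mk (σ.prod (Path.refl y))).symm.trans
      ((Path.Homotopic.Quotient.mk ((Path.refl a).prod l)).trans
        (Path.Homotopic.Quotient.mk (σ.prod (Path.refl y)))) =
      Path.Homotopic.Quotient.mk ((Path.refl b).prod l) := by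
    -- In the product the conjugation can be computed factor by factor: the first factor becomes
    -- `σ⁻¹ σ`, the second stays `l`.
    have hs : (Path.Homotopic.Quotient.mk (σ.prod (Path.refl y))).symm =
        Path.Homotopic.Quotient.mk (σ.symm.prod (Path.refl y)) := rfl
    rw [hs]
    simp only [← Path.Homotopic.prod_lift, Path.Homotopic.comp_prod_eq_prod_comp]
    simp
  have := congrArg (fun q => Path.Homotopic.Quotient.map q f) key
  simp only [quotient_map_trans] at this
  exact this

theorem mapOfEq_loopClass (f : C(X, Y)) {x : X} {y : Y} (h : f x = y) {p : Path x x}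
    {p' : Path y y} (hp : ∀ t, p' t = f (p t)) :
    FundamentalGroup.mapOfEq f h (loopClass p) = loopClass p' := by
  subst h
  have : p' = p.map f.continuous := Path.ext (funext hp)
  rw [this, FundamentalGroup.mapOfEq_apply]
  rfl

theorem map_loopClass (f : C(X, Y)) {x : X} {p : Path x x} {p' : Path (f x) (f x)}
    (hp : ∀ t, p' t = f (p t)) : FundamentalGroup.map f x (loopClass p) = loopClass p' := by
  have : p' = p.map f.continuous := Path.ext (funext hp)
  rw [this]
  rfl

theorem map_transport (f : C(X, Y)) {a b : X} {y : Y} (e : f a = y) (h : Path a b) :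
    ∃ h' : Path y (f b), ∀ x,
      FundamentalGroup.map f b (FundamentalGroup.fundamentalGroupMulEquivOfPath h x) =
        FundamentalGroup.fundamentalGroupMulEquivOfPath h' (FundamentalGroup.mapOfEq f e x) := by
  subst e
  refine ⟨h.map f.continuous, fun x => ?_⟩
  obtain ⟨p, rfl⟩ := exists_loopClass x
  rw [mapOfEq_loopClass f rfl (p' := p.map f.continuous) fun _ => rfl]
  have hmap : ∀ q : Path.Homotopic.Quotient b b, FundamentalGroup.map f b
      (FundamentalGroup.fromPath q) = FundamentalGroup.fromPath (q.map f) := fun _ => rfl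
  rw [transport_eq, transport_eq, hmap, quotient_map_trans, quotient_map_trans]
  rfl

theorem map_bijective_of_inverse (f : C(X, Y)) (k : C(Y, X)) (hkf : ∀ x, k (f x) = x)
    (hfk : ∀ y, f (k y) = y) (b : X) : Function.Bijective (FundamentalGroup.map f b) := by
  refine Function.bijective_iff_has_inverse.mpr
    ⟨FundamentalGroup.mapOfEq k (hkf b), fun γ => ?_, fun γ => ?_⟩
  · obtain ⟨p, rfl⟩ := exists_loopClass γ
    rw [map_loopClass f (p' := p.map f.continuous) fun _ => rfl]
    exact mapOfEq_loopClass k _ fun t => (hkf _).symm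
  · obtain ⟨p, rfl⟩ := exists_loopClass γ
    rw [mapOfEq_loopClass k (hkf b)
      (p' := (p.map k.continuous).cast (hkf b).symm (hkf b).symm) fun _ => rfl]
    exact map_loopClass f fun t => (hfk _).symm

theorem trans_apply_of_map {f : X → Y} {a b c : X} {a' b' c' : Y} {p : Path a b} {q : Path b c}
    {p' : Path a' b'} {q' : Path b' c'} (hp : ∀ t, p' t = f (p t)) (hq : ∀ t, q' t = f (q t))
    (t : unitInterval) : (p'.trans q') t = f ((p.trans q) t) := by
  rw [Path.trans_apply, Path.trans_apply]
  split_ifs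
  · exact hp _
  · exact hq _

theorem symm_apply_of_map {f : X → Y} {a b : X} {a' b' : Y} {p : Path a b} {p' : Path a' b'}
    (hp : ∀ t, p' t = f (p t)) (t : unitInterval) : p'.symm t = f (p.symm t) := by
  rw [Path.symm_apply, Path.symm_apply]
  exact hp _

end FundamentalGroupLemmas

/-! ### Frames and meridians. -/

section Meridians

variable {K : Knot} (T : K.Tube)

/-- The boundary torus of the tubular neighbourhood. -/
def Knot.Tube.torus : C(Circle × Circle, Compl K.image) where
  toFun q := ⟨T.map (q.1, ⟨q.2, mem_closedBall_zero_iff.mpr (Circle.norm_coe _).le⟩), by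
    rintro ⟨s', hs'⟩
    rw [← T.core] at hs'
    have := congrArg (fun q => (q.2 : ℂ)) (T.injective hs')
    exact Circle.coe_ne_zero _ this.symm⟩
  continuous_toFun := by
    refine Continuous.subtype_mk (T.map.continuous.comp (Continuous.prodMk continuous_fst ?_)) _
    exact Continuous.subtype_mk (by fun_prop) _

/-- The positively oriented unit circle as a loop. -/
def circleLoop : Path (Circle.exp (2 * Real.pi * 0)) (Circle.exp (2 * Real.pi * 0)) where
  toFun t := Circle.exp (2 * Real.pi * t)
  continuous_toFun := by fun_prop
  source' := rfl
  target' := by simp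

/-- The meridian loops around two points of the knot are freely homotopic. -/
theorem Knot.Tube.exists_conj_meridianLoop (s s' : Circle) :
    ∃ δ : Path (T.boundaryPoint s 0) (T.boundaryPoint s' 0),
      (Path.Homotopic.Quotient.mk δ).symm.trans
        ((Path.Homotopic.Quotient.mk (T.meridianLoop s)).trans (Path.Homotopic.Quotient.mk δ)) =
          Path.Homotopic.Quotient.mk (T.meridianLoop s') := by
  obtain ⟨e⟩ : Joined s s' := by
    obtain ⟨x, rfl⟩ := Circle.exp_surjective s
    obtain ⟨y, rfl⟩ := Circle.exp_surjective s'
    exact (PathConnectedSpace.joined x y).map Circle.exp.continuous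
  -- The path slides the base point along the knot at constant angle. The angle is written as `2π ·
  -- 0`, so that the loops on the torus match `meridianLoop` definitionally.
  exact ⟨(e.prod (Path.refl (Circle.exp (2 * Real.pi * 0)))).map T.torus.continuous,
    loop_conj_of_prod T.torus e circleLoop⟩

/-- The crossing loop is by assumption a meridian, based along some `γ₀`. Changing the frame only
changes the connecting path; conversely, sliding along the boundary torus by `δ` reaches any other
fibre disc, and the frame `γ₀ δ γ⁻¹` then gives the meridian with connecting path `γ`. -/
theorem RegularSplitting.isMeridian_iff {T : K.Tube} {g : ℕ} (S : RegularSplitting T g)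
    (b : Compl K.image) (m : FundamentalGroup (Compl K.image) b) :
    T.IsMeridian b m ↔ ∃ h : Path S.knotBase b, (S.pres h).meridian = m := by
  obtain ⟨s₀, γ₀, h₀⟩ := S.isMeridian
  have hmer : ∀ h : Path S.knotBase b, (S.pres h).meridian =
      FundamentalGroup.fundamentalGroupMulEquivOfPath h
        (loopClass ((γ₀.trans (T.meridianLoop s₀)).trans γ₀.symm)) :=
    fun h => congrArg (FundamentalGroup.fundamentalGroupMulEquivOfPath h) h₀
  constructor
  · rintro ⟨s, γ, rfl⟩
    obtain ⟨δ, hδ⟩ := T.exists_conj_meridianLoop s₀ s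
    exact ⟨(γ₀.trans δ).trans γ.symm, (hmer _).trans (transport_loopClass_of_conj γ₀ γ hδ)⟩
  · rintro ⟨h, rfl⟩
    exact ⟨s₀, h.symm.trans γ₀, (hmer h).trans (transport_loopClass h γ₀ (T.meridianLoop s₀))⟩

end Meridians

/-! ### Transport of the surface data under a homeomorphism of the three-sphere. -/

section Images

variable {Ψ : S3 ≃ₜ S3} {K K' : Knot} {T : K.Tube} {T' : K'.Tube} {g : ℕ}

theorem Knot.Tube.IsImage.symm (hT : Knot.Tube.IsImage Ψ T T') : Knot.Tube.IsImage Ψ.symm T' T :=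
  fun q => by rw [hT, Homeomorph.symm_apply_apply]

theorem Knot.Tube.IsImage.map_bijective (hT : Knot.Tube.IsImage Ψ T T') (b : Compl K.image) :
    Function.Bijective (FundamentalGroup.map hT.compl b) :=
  map_bijective_of_inverse hT.compl hT.symm.compl
    (fun p => Subtype.ext (Ψ.symm_apply_apply p)) (fun p => Subtype.ext (Ψ.apply_symm_apply p)) b

variable {S : RegularSplitting T g} {S' : RegularSplitting T' g}

namespace RegularSplitting.IsImage

variable (hS : RegularSplitting.IsImage Ψ S S')

/-- The map between the complements of the surfaces. -/
def compl : C(Compl S.surface.carrier, Compl S'.surface.carrier) where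
  toFun p := ⟨Ψ p, fun hp => p.2 (by
    rw [hS.carrier] at hp
    obtain ⟨q, hq, hqp⟩ := hp
    exact Ψ.injective hqp ▸ hq)⟩
  continuous_toFun := Continuous.subtype_mk (Ψ.continuous.comp continuous_subtype_val) _

theorem compl_base : hS.compl S.base = S'.base := Subtype.ext hS.base.symm

theorem words_eq (w : FreeGroup (Fin (2 * g))) :
    S'.words w = FundamentalGroup.mapOfEq hS.compl hS.compl_base (S.words w) := by
  have : S'.words.toMonoidHom =
      (FundamentalGroup.mapOfEq hS.compl hS.compl_base).comp S.words.toMonoidHom := by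
    refine FreeGroup.ext_hom _ _ fun i => ?_
    change FreeGroup.lift (fun i => loopClass (S'.gen i)) (FreeGroup.of i) =
      FundamentalGroup.mapOfEq hS.compl hS.compl_base
        (FreeGroup.lift (fun i => loopClass (S.gen i)) (FreeGroup.of i))
    rw [FreeGroup.lift_apply_of, FreeGroup.lift_apply_of]
    exact (mapOfEq_loopClass hS.compl hS.compl_base fun t => Subtype.ext (hS.gen i t)).symm
  exact DFunLike.congr_fun this w

theorem flat_eq (j : Fin (2 * g)) :
    S'.flat j = FundamentalGroup.mapOfEq hS.compl hS.compl_base (S.flat j) := by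
  refine (mapOfEq_loopClass hS.compl hS.compl_base ?_).symm
  have hd : ∀ t, S'.down t = hS.compl (S.down t) := fun t => Subtype.ext (hS.down t)
  exact trans_apply_of_map (trans_apply_of_map hd fun t =>
    Subtype.ext (hS.collar _ _ _ (hS.loop j t))) (symm_apply_of_map hd)

theorem sharp_eq (j : Fin (2 * g)) :
    S'.sharp j = FundamentalGroup.mapOfEq hS.compl hS.compl_base (S.sharp j) := by
  refine (mapOfEq_loopClass hS.compl hS.compl_base ?_).symm
  have hd : ∀ t, S'.up t = hS.compl (S.up t) := fun t => Subtype.ext (hS.up t)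
  exact trans_apply_of_map (trans_apply_of_map hd fun t =>
    Subtype.ext (hS.collar _ _ _ (hS.loop j t))) (symm_apply_of_map hd)

/-- The chosen free generators correspond under `Ψ`, so corresponding loops are spelled by the same
word. This is why `yⱼ` and `zⱼ` are unchanged. -/
theorem words_symm_eq {γ : FundamentalGroup (Compl S.surface.carrier) S.base}
    {γ' : FundamentalGroup (Compl S'.surface.carrier) S'.base}
    (h : γ' = FundamentalGroup.mapOfEq hS.compl hS.compl_base γ) :
    S'.words.symm γ' = S.words.symm γ := by
  rw [MulEquiv.symm_apply_eq, hS.words_eq, MulEquiv.apply_symm_apply, h]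

variable (hT : Knot.Tube.IsImage Ψ T T')

include hS in
theorem compl_knotBase : hT.compl S.knotBase = S'.knotBase := Subtype.ext hS.base.symm

theorem meridian_eq :
    S'.meridian = FundamentalGroup.mapOfEq hT.compl (hS.compl_knotBase hT) S.meridian := by
  refine (mapOfEq_loopClass hT.compl (hS.compl_knotBase hT) ?_).symm
  exact trans_apply_of_map (trans_apply_of_map (fun t => Subtype.ext (hS.down t)) fun t =>
    Subtype.ext (hS.collar _ _ _ hS.pt)) (symm_apply_of_map fun t => Subtype.ext (hS.up t))

include hS in
/-- The presentations of the knot groups of `K` and of its image `K'` agree up to a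
conjugation. -/
theorem pres_eq {b : Compl K.image} (h : Path S.knotBase b)
    (h' : Path S'.knotBase (hT.compl b)) :
    ∃ γ : FundamentalGroup (Compl K'.image) (hT.compl b),
      (S'.pres h').meridian =
        γ * FundamentalGroup.map hT.compl b (S.pres h).meridian * γ⁻¹ ∧
      (∀ i, (S'.pres h').x i =
        γ * FundamentalGroup.map hT.compl b ((S.pres h).x i) * γ⁻¹) ∧
      (S'.pres h').y = (S.pres h).y ∧ (S'.pres h').z = (S.pres h).z := by
  -- The image `h''` of the frame `h` gives exact agreement; the given frame `h'` differs from it by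
  -- the conjugation by `γ`.
  obtain ⟨h'', hh''⟩ := map_transport hT.compl (hS.compl_knotBase hT) h
  obtain ⟨γ, hγ⟩ := transport_eq_conj h'' h'
  refine ⟨γ, ?_, fun i => ?_, ?_, ?_⟩
  · change FundamentalGroup.fundamentalGroupMulEquivOfPath h' S'.meridian = _
    rw [hγ, hS.meridian_eq hT, ← hh'']
    rfl
  · change FundamentalGroup.fundamentalGroupMulEquivOfPath h' (loopClass _) = _
    rw [hγ]
    change _ = γ * FundamentalGroup.map hT.compl b
      (FundamentalGroup.fundamentalGroupMulEquivOfPath h (loopClass _)) * γ⁻¹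
    rw [hh'', mapOfEq_loopClass hT.compl (hS.compl_knotBase hT)
      (p := (S.gen i).map S.surface.incl.continuous)
      (p' := (S'.gen i).map S'.surface.incl.continuous) fun t => Subtype.ext (hS.gen i t)]
  · exact funext fun j => hS.words_symm_eq (hS.flat_eq j)
  · exact funext fun j => hS.words_symm_eq (hS.sharp_eq j)

end RegularSplitting.IsImage

end Images

/-! ### Bookkeeping for the adjoined element `0`. -/

section WithZeroMaps

variable {L M Q Q' : Type*} [Group M] [Group Q] [Group Q'] {f : Q →* M} {f' : Q' →* M}
  {x : WithZero Q} {x' : WithZero Q'}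

theorem recZeroCoe_map' (f : Q →* M) (F : M → L) (x : WithZero Q) :
    (WithZero.recZeroCoe 0 (fun k => (F k : WithZero L)) (WithZero.map' f x) : WithZero L) =
      WithZero.recZeroCoe 0 (fun k => (F (f k) : WithZero L)) x := by
  cases x <;> rfl

theorem recZeroCoe_congr (F : M → L) (h : WithZero.map' f x = WithZero.map' f' x') :
    (WithZero.recZeroCoe 0 (fun k => (F (f k) : WithZero L)) x : WithZero L) =
      WithZero.recZeroCoe 0 (fun k => (F (f' k) : WithZero L)) x' := by
  rw [← recZeroCoe_map', h, recZeroCoe_map']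

theorem map'_comp_congr [Group L] (F : M →* L) (h : WithZero.map' f x = WithZero.map' f' x') :
    WithZero.map' (F.comp f) x = WithZero.map' (F.comp f') x' := by
  rw [← WithZero.map'_map', ← WithZero.map'_map', h]

end WithZeroMaps

/-! ### Independence of the meridian for the `K₁`-invariant. -/

section MeridianChange

open SkewLaurent

variable {A : Type*} [Ring A] {κ κ' : RingAut A} {G : Type*} [Group G] {g : ℕ}

/-- The unit `ρ(γ)` of `A_κ((τ))`. -/
def repUnit (ρ : IntGroupRing G →+* SkewLaurent κ) : G →* (SkewLaurent κ)ˣ :=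
  (ρ.toMonoidHom.comp (MonoidAlgebra.of ℤ G)).toHomUnits

theorem val_repUnit (ρ : IntGroupRing G →+* SkewLaurent κ) (γ : G) :
    (repUnit ρ γ : SkewLaurent κ) = ρ (MonoidAlgebra.of ℤ G γ) := rfl

theorem rep_conj (ρ : IntGroupRing G →+* SkewLaurent κ) (γ x : G) :
    ρ (MonoidAlgebra.of ℤ G (γ * x * γ⁻¹)) = repUnit ρ γ * ρ (MonoidAlgebra.of ℤ G x) *
      ((repUnit ρ γ)⁻¹ : (SkewLaurent κ)ˣ) := by
  rw [← val_repUnit, map_mul, map_mul, map_inv]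
  rfl

/-- This reduces the claim about the quotient groups to the sharper equality in `K₁(A_id((t)))`. -/
theorem containerMap_alexInvariant {κ : RingAut A} {N : ℕ} (h : κ ^ N = 1) (P : Presentation G g)
    (ρ : IntGroupRing G →+* SkewLaurent κ) :
    WithZero.map' (containerMap h) (alexInvariant P ρ) =
      WithZero.map' (QuotientGroup.mk' _) (WithZero.map' (moritaUpsilon h) (alexClass P ρ)) := by
  rw [alexInvariant]
  cases alexClass P ρ with
  | zero => rfl
  | coe k => rfl

theorem containerMap_alexInvariant_eq {P P' : Presentation G g} {γ : G}
    {ρ : IntGroupRing G →+* SkewLaurent κ} {ρ' : IntGroupRing G →+* SkewLaurent κ'}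
    (hm : P'.meridian = γ * P.meridian * γ⁻¹) (hx : ∀ i, P'.x i = γ * P.x i * γ⁻¹)
    (hy : P'.y = P.y) (hz : P'.z = P.z) (hρ : Dagger P ρ)
    (hρ' : IsMeridianChange ρ P'.meridian ρ') {N : ℕ} (hκ : κ ^ N = 1) :
    ∃ hκ' : κ' ^ N = 1, WithZero.map' (containerMap hκ) (alexInvariant P ρ) =
      WithZero.map' (containerMap hκ') (alexInvariant P' ρ') := by
  obtain ⟨⟨c, hcm, hc⟩, hcoeff⟩ := hρ'
  have hmc : repUnit ρ P'.meridian = twistTau κ c := Units.ext hcm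
  -- Applying `ρ` to `𝔪' = γ 𝔪 γ⁻¹`, with `ρ(𝔪) = τ`, yields the conjugating unit `u = ρ(γ)`.
  have hu : twistTau κ c = repUnit ρ γ * tau κ * (repUnit ρ γ)⁻¹ := by
    rw [← hmc, hm, map_mul, map_mul, map_inv]
    congr 2
    exact Units.ext hρ.1
  -- Since `ρ(𝔪'ⁿ) = (c τ)ⁿ = cₙ τⁿ`, the coefficient condition for a change of meridian says
  -- precisely that the substitution carries `ρ'` to `ρ`.
  have hθ : ∀ δ, substTau hc (ρ' (MonoidAlgebra.of ℤ G δ)) = ρ (MonoidAlgebra.of ℤ G δ) := by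
    intro δ
    ext n
    rw [hcoeff, coeff_substTau, ← val_repUnit ρ (P'.meridian ^ n), map_zpow, hmc,
      val_twistTau_zpow, coeff_monomial, if_pos rfl]
  have hx' : ∀ i, substTau hc (ρ' (MonoidAlgebra.of ℤ G (P'.x i))) =
      repUnit ρ γ * ρ (MonoidAlgebra.of ℤ G (P.x i)) *
        ((repUnit ρ γ)⁻¹ : (SkewLaurent κ)ˣ) := fun i => by
    rw [hθ, hx, rep_conj]
  refine ⟨(pow_eq_one_iff_of_twist hc hu N).mp hκ, ?_⟩
  rw [containerMap_alexInvariant, containerMap_alexInvariant,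
    moritaUpsilon_alexClass_eq hc hu hx' hy hz rfl]

end MeridianChange

/-! ### Representations over group rings and metafinite polynomials. -/

section GroupRings

open SkewLaurent

variable {G G' H : Type*} [Group G] [Group G'] [Group H] {B : Type*} [CommRing B] {g : ℕ}

theorem inducedRep_of {lk : G →* Multiplicative ℤ} {r : lk.ker →* H} {m : G} {φ : MulAut H}
    (hm : lk m = Multiplicative.ofAdd 1) (hr : IsEquivariant r m φ) (γ : G) :
    inducedRep B r hm hr (MonoidAlgebra.of ℤ G γ) = monomial (lk γ).toAdd
      (MonoidAlgebra.of B H (r ⟨γ * m ^ (-(lk γ).toAdd), mul_zpow_mem_ker hm γ⟩)) := by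
  rw [inducedRep]
  exact (MonoidAlgebra.liftNC_single _ _ _ _).trans (by simp)

/-- The decomposition `γ = k mⁿ` with `k ∈ ker(lk)` is unique, so any such decomposition may be used
to evaluate the representation. -/
theorem inducedRep_of_eq {lk : G →* Multiplicative ℤ} {r : lk.ker →* H} {m : G} {φ : MulAut H}
    (hm : lk m = Multiplicative.ofAdd 1) (hr : IsEquivariant r m φ) {γ : G} {n : ℤ} (k : lk.ker)
    (hk : k.1 * m ^ n = γ) :
    inducedRep B r hm hr (MonoidAlgebra.of ℤ G γ) = monomial n (MonoidAlgebra.of B H (r k)) := by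
  have hn : (lk γ).toAdd = n := by
    rw [← hk, map_mul, MonoidHom.mem_ker.mp k.2, one_mul, map_zpow, hm, ← ofAdd_zsmul]
    simp
  rw [inducedRep_of]
  congr 3
  refine Subtype.ext ?_
  change γ * m ^ (-(lk γ).toAdd) = k.1
  rw [hn, ← hk, zpow_neg, mul_inv_cancel_right]

/-- `P'` is, up to a conjugation, the image of the presentation `P` under an isomorphism that
carries `lk` and `r` to `lk'` and `r'`. -/
structure PresentationIso (P : Presentation G g) (P' : Presentation G' g)
    (lk : G →* Multiplicative ℤ) (lk' : G' →* Multiplicative ℤ) (r : lk.ker →* H)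
    (r' : lk'.ker →* H) where
  hom : G →* G'
  bijective : Function.Bijective hom
  conjBy : G
  meridian : P'.meridian = hom (conjBy * P.meridian * conjBy⁻¹)
  x : ∀ i, P'.x i = hom (conjBy * P.x i * conjBy⁻¹)
  y : P'.y = P.y
  z : P'.z = P.z
  lk_hom : ∀ γ, lk' (hom γ) = lk γ
  r_hom : ∀ (γ : lk.ker) (γ' : lk'.ker), γ'.1 = hom γ → r' γ' = r γ

namespace PresentationIso

variable {P : Presentation G g} {P' : Presentation G' g} {lk : G →* Multiplicative ℤ}
  {lk' : G' →* Multiplicative ℤ} {r : lk.ker →* H} {r' : lk'.ker →* H}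
  (E : PresentationIso P P' lk lk' r r') {φ φ' : MulAut H}

include E in
theorem lk_meridian (hm : lk P.meridian = Multiplicative.ofAdd 1) :
    lk' P'.meridian = Multiplicative.ofAdd 1 := by
  rw [E.meridian, E.lk_hom, map_mul, map_mul, map_inv, mul_inv_cancel_comm, hm]

/-- The element `r(𝔪' 𝔪⁻¹)`, where `𝔪'` is regarded as a meridian of the first presentation. -/
def quot : H :=
  r ⟨E.conjBy * P.meridian * E.conjBy⁻¹ * P.meridian⁻¹, by
    rw [MonoidHom.mem_ker, map_mul, map_mul, map_mul, map_inv, map_inv, mul_inv_cancel_comm,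
      mul_inv_cancel]⟩

/-- Pulled back to `G`, the new meridian is `(𝔪' 𝔪⁻¹) 𝔪`. Conjugation by `𝔪` acts through `φ`, and
the first factor lies in `ker(lk)`, so it acts as conjugation by its image `E.quot`. -/
theorem r_conj (hφ : IsEquivariant r P.meridian φ) (γ' : lk'.ker) :
    r' (MulAut.conjNormal P'.meridian γ') = E.quot * φ (r' γ') * E.quot⁻¹ := by
  obtain ⟨γ, hγ⟩ := E.bijective.2 γ'.1
  have hker : γ ∈ lk.ker := by
    rw [MonoidHom.mem_ker, ← E.lk_hom, hγ]
    exact γ'.2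
  rw [E.r_hom ⟨γ, hker⟩ γ' hγ.symm, ← hφ, quot, ← map_inv, ← map_mul, ← map_mul]
  refine E.r_hom _ _ ?_
  rw [MulAut.conjNormal_apply, E.meridian, ← hγ, ← map_mul, ← map_inv, ← map_mul]
  congr 1
  simp only [Subgroup.coe_mul, Subgroup.coe_inv, MulAut.conjNormal_apply]
  group

include E in
theorem exists_equivariant (hφ : IsEquivariant r P.meridian φ) :
    ∃ φ' : MulAut H, IsEquivariant r' P'.meridian φ' :=
  ⟨MulAut.conj E.quot * φ, fun γ' => by rw [E.r_conj hφ]; rfl⟩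

/-- Surjectivity of `r` leaves no freedom in the choice of `φ'`. -/
theorem equivariant_apply (hφ : IsEquivariant r P.meridian φ)
    (hφ' : IsEquivariant r' P'.meridian φ') (hr : Function.Surjective r) (a : H) :
    φ' a = E.quot * φ a * E.quot⁻¹ := by
  obtain ⟨γ, rfl⟩ := hr a
  have hker : E.hom γ ∈ lk'.ker := by
    rw [MonoidHom.mem_ker, E.lk_hom]
    exact γ.2
  rw [← E.r_hom γ ⟨E.hom γ, hker⟩ rfl, ← hφ', E.r_conj hφ]

/-- The unit of the group ring given by `E.quot`. -/
def quotUnit (B : Type*) [CommRing B] : (MonoidAlgebra B H)ˣ :=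
  Units.map (MonoidAlgebra.of B H) (toUnits E.quot)

theorem groupRingAut_apply (hφ : IsEquivariant r P.meridian φ)
    (hφ' : IsEquivariant r' P'.meridian φ') (hr : Function.Surjective r) (a : MonoidAlgebra B H) :
    groupRingAut B φ' a = E.quotUnit B * groupRingAut B φ a * ((E.quotUnit B)⁻¹ : _ˣ) := by
  have hs : ∀ (φ : MulAut H) (h : H) (b : B),
      groupRingAut B φ (MonoidAlgebra.single h b) = MonoidAlgebra.single (φ h) b :=
    fun φ h b => MonoidAlgebra.mapDomain_single
  have hq : ((E.quotUnit B : (MonoidAlgebra B H)ˣ) : MonoidAlgebra B H) =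
      MonoidAlgebra.single E.quot 1 := rfl
  have hq' : (((E.quotUnit B)⁻¹ : (MonoidAlgebra B H)ˣ) : MonoidAlgebra B H) =
      MonoidAlgebra.single E.quot⁻¹ 1 := rfl
  induction a using MonoidAlgebra.induction_linear with
  | zero => simp
  | add x y hx hy => rw [map_add, map_add, mul_add, add_mul, hx, hy]
  | single h b =>
    rw [hs, hs, hq, hq', MonoidAlgebra.single_mul_single, MonoidAlgebra.single_mul_single,
      one_mul, mul_one, E.equivariant_apply hφ hφ' hr]

variable (hm : lk P.meridian = Multiplicative.ofAdd 1)
  (hm' : lk' P'.meridian = Multiplicative.ofAdd 1)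
  (hφ : IsEquivariant r P.meridian φ) (hφ' : IsEquivariant r' P'.meridian φ')
  (hr : Function.Surjective r)

theorem repUnit_meridian :
    repUnit (inducedRep B r hm hφ) (E.conjBy * P.meridian * E.conjBy⁻¹) =
      twistTau (groupRingAut B φ) (E.quotUnit B) := by
  refine Units.ext ?_
  rw [val_repUnit, inducedRep_of_eq hm hφ (n := 1) ⟨E.conjBy * P.meridian * E.conjBy⁻¹ *
    P.meridian⁻¹, _⟩ (by rw [zpow_one, inv_mul_cancel_right]), val_twistTau, C_mul_tau]
  rfl

theorem twistTau_eq :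
    twistTau (groupRingAut B φ) (E.quotUnit B) =
      repUnit (inducedRep B r hm hφ) E.conjBy * tau (groupRingAut B φ) *
        (repUnit (inducedRep B r hm hφ) E.conjBy)⁻¹ := by
  rw [← E.repUnit_meridian hm hφ, map_mul, map_mul, map_inv]
  congr 2
  refine Units.ext ?_
  rw [val_repUnit, inducedRep_of_eq hm hφ (n := 1) 1 (by simp), map_one, map_one]
  rfl

/-- Write `γ = k 𝔪'ⁿ` with `𝔪'` pulled back to `G`. Then `ρ(γ) = r(k) (c τ)ⁿ`, whereas `ρ'` sends
the image of `γ` to `r(k) τ'ⁿ`; the substitution identifies the two. -/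
theorem substTau_inducedRep (γ : G) :
    substTau (E.groupRingAut_apply hφ hφ' hr)
        (inducedRep B r' hm' hφ' (MonoidAlgebra.of ℤ G' (E.hom γ))) =
      inducedRep B r hm hφ (MonoidAlgebra.of ℤ G γ) := by
  set n := (lk γ).toAdd with hn
  set m'' := E.conjBy * P.meridian * E.conjBy⁻¹ with hm''
  have hlm : lk m'' = Multiplicative.ofAdd 1 := by
    rw [← E.lk_hom, ← E.meridian, hm']
  have hker : γ * m'' ^ (-n) ∈ lk.ker := mul_zpow_mem_ker hlm γ
  have h1 : repUnit (inducedRep B r hm hφ) γ =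
      repUnit (inducedRep B r hm hφ) (γ * m'' ^ (-n)) *
        twistTau (groupRingAut B φ) (E.quotUnit B) ^ n := by
    rw [← E.repUnit_meridian hm hφ, ← map_zpow, ← map_mul]
    congr 1
    rw [mul_assoc, ← zpow_add]
    simp
  have hker' : E.hom (γ * m'' ^ (-n)) ∈ lk'.ker := by
    rw [MonoidHom.mem_ker, E.lk_hom]
    exact hker
  rw [← val_repUnit (inducedRep B r hm hφ), h1, Units.val_mul, val_twistTau_zpow, val_repUnit,
    inducedRep_of_eq hm hφ (n := 0) ⟨γ * m'' ^ (-n), hker⟩ (by simp),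
    inducedRep_of_eq hm' hφ' (n := n) ⟨E.hom (γ * m'' ^ (-n)), hker'⟩ (by
      rw [E.meridian, ← map_zpow, ← map_mul, zpow_neg, inv_mul_cancel_right]), substTau_monomial, monomial_mul_monomial, E.r_hom ⟨γ * m'' ^ (-n), hker⟩ _ rfl,
    zero_add, zpow_zero, RingAut.one_apply]

theorem substTau_x (i : Fin (2 * g)) :
    substTau (E.groupRingAut_apply hφ hφ' hr)
        (inducedRep B r' hm' hφ' (MonoidAlgebra.of ℤ G' (P'.x i))) =
      repUnit (inducedRep B r hm hφ) E.conjBy *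
        inducedRep B r hm hφ (MonoidAlgebra.of ℤ G (P.x i)) *
          ((repUnit (inducedRep B r hm hφ) E.conjBy)⁻¹ : _ˣ) := by
  rw [E.x, E.substTau_inducedRep hm hm' hφ hφ' hr, rep_conj]

include E hm hφ hφ' hr in
theorem groupRingAut_pow_eq_one_iff (N : ℕ) :
    groupRingAut B φ ^ N = 1 ↔ groupRingAut B φ' ^ N = 1 :=
  pow_eq_one_iff_of_twist (E.groupRingAut_apply hφ hφ' hr) (E.twistTau_eq hm hφ) N

include E hr in
theorem moritaUpsilon_alexClass_eq {N N' : ℕ} (hN : N = N') (h : groupRingAut B φ ^ N = 1)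
    (h' : groupRingAut B φ' ^ N' = 1) :
    WithZero.map' (moritaUpsilon h) (alexClass P (inducedRep B r hm hφ)) =
      WithZero.map' (moritaUpsilon h') (alexClass P' (inducedRep B r' hm' hφ')) :=
  KnotK1.moritaUpsilon_alexClass_eq (E.groupRingAut_apply hφ hφ' hr) (E.twistTau_eq hm hφ)
    (E.substTau_x hm hm' hφ hφ' hr) E.y E.z hN h h'

include E hr in
theorem metafinitePolynomial_eq :
    metafinitePolynomial B P r hm hφ = metafinitePolynomial B P' r' hm' hφ' := by
  -- The minimal exponents are the orders of the two automorphisms, which agree. Equality of the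
  -- classes in `K₁` ensures that the same chosen unit represents both, so no property of that
  -- choice is needed.
  have key := E.moritaUpsilon_alexClass_eq hm hm' hφ hφ' hr
    (orderOf_eq_orderOf_iff.mpr (E.groupRingAut_pow_eq_one_iff (B := B) hm hφ hφ' hr))
    (pow_orderOf_eq_one _) (pow_orderOf_eq_one _)
  exact recZeroCoe_congr (fun q => Subgroup.quotientMapOfLE
    (le_sup_left : _ ≤ detIndeterminacy (MonoidAlgebra B H)) (whiteheadDet q)) key

end PresentationIso

/-! ### Metabelian polynomials. -/

section Metabelian

variable {H : Type*} [CommGroup H]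

theorem PresentationIso.metabelianPolynomial_eq {P : Presentation G g} {P' : Presentation G' g}
    {lk : G →* Multiplicative ℤ} {lk' : G' →* Multiplicative ℤ} {r : lk.ker →* H}
    {r' : lk'.ker →* H} (E : PresentationIso P P' lk lk' r r') {φ φ' : MulAut H}
    (hm : lk P.meridian = Multiplicative.ofAdd 1)
    (hm' : lk' P'.meridian = Multiplicative.ofAdd 1)
    (hφ : IsEquivariant r P.meridian φ) (hφ' : IsEquivariant r' P'.meridian φ')
    (hr : Function.Surjective r) {N : ℕ} (h : groupRingAut ℚ φ ^ N = 1)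
    (h' : groupRingAut ℚ φ' ^ N = 1) :
    metabelianPolynomial P r hm hφ h = metabelianPolynomial P' r' hm' hφ' h' := by
  have key := E.moritaUpsilon_alexClass_eq hm hm' hφ hφ' hr rfl h h'
  exact map'_comp_congr ((QuotientGroup.mk' _).comp (K1.det _)) key

variable {lk : G →* Multiplicative ℤ} {N : ℕ} {r : lk.ker →* H}

/-- The linking number factors through the homology of the covering, and `ℤ` is torsion-free. -/
theorem mem_ker_of_torsion {δ : cyclicSubgroup lk N}
    (hδ : Abelianization.of δ ∈ CommGroup.torsion (CyclicH1 lk N)) : δ.1 ∈ lk.ker := by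
  let L : CyclicH1 lk N →* Multiplicative ℤ :=
    Abelianization.lift (lk.comp (cyclicSubgroup lk N).subtype)
  have h1 : IsOfFinOrder (L (Abelianization.of δ)) := L.isOfFinOrder hδ
  have h2 : L (Abelianization.of δ) = lk δ.1 := rfl
  rw [h2, isOfFinOrder_iff_pow_eq_one] at h1
  obtain ⟨n, hn, h1⟩ := h1
  rw [MonoidHom.mem_ker]
  have h3 : n • (lk δ.1).toAdd = 0 := h1
  have h4 := (smul_eq_zero.mp h3).resolve_left hn.ne'
  exact h4

namespace IsMetabelian

/-- A representative of the torsion class of `a` automatically lies in `ker(lk)`, where the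
condition on `r` applies. Besides surjectivity, this provides preimages on which `r` is known
explicitly. -/
theorem exists_torsion (hr : IsMetabelian N r) (a : H) :
    ∃ γ : lk.ker, kerToH1 lk N γ ∈ CommGroup.torsion (CyclicH1 lk N) ∧ r γ = a := by
  obtain ⟨ι, hι⟩ := hr
  obtain ⟨δ, hδ⟩ := QuotientGroup.mk_surjective (ι a : CyclicH1 lk N)
  have hδ' : Abelianization.of δ = (ι a : CyclicH1 lk N) := hδ
  have hker : δ.1 ∈ lk.ker := mem_ker_of_torsion (hδ' ▸ (ι a).2)
  have hcl : kerToH1 lk N ⟨δ.1, hker⟩ = (ι a : CyclicH1 lk N) := hδ'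
  have ht : kerToH1 lk N ⟨δ.1, hker⟩ ∈ CommGroup.torsion (CyclicH1 lk N) := hcl ▸ (ι a).2
  exact ⟨⟨δ.1, hker⟩, ht, ι.injective (Subtype.ext ((hι _ ht).trans hcl))⟩

theorem surjective (hr : IsMetabelian N r) : Function.Surjective r := fun a =>
  let ⟨γ, _, hγ⟩ := hr.exists_torsion a
  ⟨γ, hγ⟩

/-- Conjugation by `mᴺ` is inner in the fundamental group of the `N`-fold covering, hence trivial on
its homology. Testing on elements with torsion class suffices, since they map onto `H`. -/
theorem pow_eq_one (hr : IsMetabelian N r) {m : G} {φ : MulAut H}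
    (hm : lk m = Multiplicative.ofAdd 1) (hφ : IsEquivariant r m φ) : φ ^ N = 1 := by
  refine MulEquiv.ext fun a => ?_
  obtain ⟨γ, ht, rfl⟩ := hr.exists_torsion a
  have hmN : m ^ (N : ℤ) ∈ cyclicSubgroup lk N := by
    rw [cyclicSubgroup, Subgroup.mem_comap, map_zpow, hm, ← ofAdd_zsmul]
    simp
  have hcl : kerToH1 lk N (MulAut.conjNormal (m ^ (N : ℤ)) γ) = kerToH1 lk N γ := by
    have : Subgroup.inclusion (ker_le_cyclicSubgroup lk N) (MulAut.conjNormal (m ^ (N : ℤ)) γ) =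
        ⟨m ^ (N : ℤ), hmN⟩ * Subgroup.inclusion (ker_le_cyclicSubgroup lk N) γ *
          ⟨m ^ (N : ℤ), hmN⟩⁻¹ := Subtype.ext (MulAut.conjNormal_apply _ _)
    rw [kerToH1, MonoidHom.comp_apply, MonoidHom.comp_apply, this, map_mul, map_mul, map_inv,
      mul_inv_cancel_comm]
  obtain ⟨ι, hι⟩ := hr
  have h1 := hφ.zpow N γ
  rw [zpow_natCast φ] at h1
  rw [← h1, MulAut.one_apply]
  exact ι.injective (Subtype.ext ((hι _ (hcl ▸ ht)).trans (hcl.trans (hι _ ht).symm)))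

theorem groupRingAut_pow_eq_one (B : Type*) [CommRing B] (hr : IsMetabelian N r) {m : G}
    {φ : MulAut H} (hm : lk m = Multiplicative.ofAdd 1) (hφ : IsEquivariant r m φ) :
    groupRingAut B φ ^ N = 1 := by
  rw [← map_pow, hr.pow_eq_one hm hφ, map_one]

end IsMetabelian

end Metabelian

end GroupRings

/-! ### Application to the knot groups. -/

section KnotGroups

variable {Ψ : S3 ≃ₜ S3} {K K' : Knot} {T : K.Tube} {T' : K'.Tube} {g : ℕ}
  {S : RegularSplitting T g} {S' : RegularSplitting T' g} {H : Type*} [Group H]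

theorem RegularSplitting.IsImage.nonempty_presentationIso
    (hS : RegularSplitting.IsImage Ψ S S') (hT : Knot.Tube.IsImage Ψ T T') {b : Compl K.image}
    (h : Path S.knotBase b) (h' : Path S'.knotBase (hT.compl b))
    {lk : FundamentalGroup (Compl K.image) b →* Multiplicative ℤ}
    {lk' : FundamentalGroup (Compl K'.image) (hT.compl b) →* Multiplicative ℤ}
    {r : lk.ker →* H} {r' : lk'.ker →* H}
    (hlk : ∀ γ, lk' (FundamentalGroup.map hT.compl b γ) = lk γ)
    (hr : ∀ (γ : lk.ker) (γ' : lk'.ker),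
      γ'.1 = FundamentalGroup.map hT.compl b γ → r' γ' = r γ) :
    Nonempty (PresentationIso (S.pres h) (S'.pres h') lk lk' r r') := by
  obtain ⟨γ', hm, hx, hy, hz⟩ := hS.pres_eq hT h h'
  have hbij := hT.map_bijective b
  -- The conjugating element is pulled back to the first knot group, where `ρ` can be evaluated on
  -- it.
  obtain ⟨γ, rfl⟩ := hbij.2 γ'
  exact ⟨⟨FundamentalGroup.map hT.compl b, hbij, γ, by rw [hm, map_mul, map_mul, map_inv],
    fun i => by rw [hx, map_mul, map_mul, map_inv], hy, hz, hlk, hr⟩⟩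

theorem RegularSplitting.pres_conj (S : RegularSplitting T g) {b : Compl K.image}
    (h h' : Path S.knotBase b) : ∃ γ : FundamentalGroup (Compl K.image) b,
      (S.pres h').meridian = γ * (S.pres h).meridian * γ⁻¹ ∧
        ∀ i, (S.pres h').x i = γ * (S.pres h).x i * γ⁻¹ := by
  obtain ⟨γ, hγ⟩ := transport_eq_conj h h'
  exact ⟨γ, hγ _, fun i => hγ _⟩

end KnotGroups

end KnotK1

end

theorem proposition4p5 {K : KnotK1.Knot} (T : K.Tube) {g : ℕ}
    (S : KnotK1.RegularSplitting T g) :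
    -- the frames `h` give exactly the meridians of the knot
    (∀ (b : KnotK1.Compl K.image) (m : FundamentalGroup (KnotK1.Compl K.image) b),
      T.IsMeridian b m ↔ ∃ h : Path S.knotBase b, (S.pres h).meridian = m) ∧
    -- the pushforward of the `K₁`-Alexander invariant does not depend on the meridian
    (∀ (b : KnotK1.Compl K.image) (h h' : Path S.knotBase b)
      (A : Type*) [Ring A] (κ κ' : RingAut A)
      (ρ : KnotK1.IntGroupRing (FundamentalGroup (KnotK1.Compl K.image) b) →+*
        KnotK1.SkewLaurent κ)
      (ρ' : KnotK1.IntGroupRing (FundamentalGroup (KnotK1.Compl K.image) b) →+*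
        KnotK1.SkewLaurent κ')
      (N : ℕ), 0 < N → ∀ hκ : κ ^ N = 1,
      KnotK1.Dagger (S.pres h) ρ →
      KnotK1.IsMeridianChange ρ (S.pres h').meridian ρ' →
      ∃ hκ' : κ' ^ N = 1,
        WithZero.map' (KnotK1.containerMap hκ) (KnotK1.alexInvariant (S.pres h) ρ) =
          WithZero.map' (KnotK1.containerMap hκ') (KnotK1.alexInvariant (S.pres h') ρ')) ∧
    -- metafinite Alexander polynomials do not depend on the meridian and are knot invariants
    (∀ (b : KnotK1.Compl K.image) (h : Path S.knotBase b) (B : Type*) [CommRing B]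
      (H : Type*) [Group H] [Finite H]
      (lk : FundamentalGroup (KnotK1.Compl K.image) b →* Multiplicative ℤ) (r : lk.ker →* H)
      (φ : MulAut H) (hm : lk (S.pres h).meridian = Multiplicative.ofAdd 1)
      (hφ : KnotK1.IsEquivariant r (S.pres h).meridian φ), Function.Surjective r →
      ∀ (K' : KnotK1.Knot) (T' : K'.Tube) (Ψ : KnotK1.S3 ≃ₜ KnotK1.S3)
        (hT : KnotK1.Knot.Tube.IsImage Ψ T T') (S' : KnotK1.RegularSplitting T' g),
        KnotK1.RegularSplitting.IsImage Ψ S S' →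
      ∀ (h' : Path S'.knotBase (hT.compl b))
        (lk' : FundamentalGroup (KnotK1.Compl K'.image) (hT.compl b) →* Multiplicative ℤ)
        (r' : lk'.ker →* H),
        (∀ γ, lk' (FundamentalGroup.map hT.compl b γ) = lk γ) →
        (∀ (γ : lk.ker) (γ' : lk'.ker),
          γ'.1 = FundamentalGroup.map hT.compl b γ → r' γ' = r γ) →
      ∃ hm' : lk' (S'.pres h').meridian = Multiplicative.ofAdd 1,
        (∃ φ' : MulAut H, KnotK1.IsEquivariant r' (S'.pres h').meridian φ') ∧
        ∀ (φ' : MulAut H) (hφ' : KnotK1.IsEquivariant r' (S'.pres h').meridian φ'),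
          KnotK1.metafinitePolynomial B (S.pres h) r hm hφ =
            KnotK1.metafinitePolynomial B (S'.pres h') r' hm' hφ') ∧
    -- metabelian Alexander polynomials do not depend on the meridian and are knot invariants
    (∀ (b : KnotK1.Compl K.image) (h : Path S.knotBase b) (N : ℕ) (H : Type*) [CommGroup H]
      (lk : FundamentalGroup (KnotK1.Compl K.image) b →* Multiplicative ℤ) (r : lk.ker →* H)
      (φ : MulAut H) (hm : lk (S.pres h).meridian = Multiplicative.ofAdd 1)
      (hφ : KnotK1.IsEquivariant r (S.pres h).meridian φ), 0 < N →
      KnotK1.IsMetabelian N r →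
      ∃ hκ : KnotK1.groupRingAut ℚ φ ^ N = 1,
      ∀ (K' : KnotK1.Knot) (T' : K'.Tube) (Ψ : KnotK1.S3 ≃ₜ KnotK1.S3)
        (hT : KnotK1.Knot.Tube.IsImage Ψ T T') (S' : KnotK1.RegularSplitting T' g),
        KnotK1.RegularSplitting.IsImage Ψ S S' →
      ∀ (h' : Path S'.knotBase (hT.compl b))
        (lk' : FundamentalGroup (KnotK1.Compl K'.image) (hT.compl b) →* Multiplicative ℤ)
        (r' : lk'.ker →* H),
        (∀ γ, lk' (FundamentalGroup.map hT.compl b γ) = lk γ) →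
        (∀ (γ : lk.ker) (γ' : lk'.ker),
          γ'.1 = FundamentalGroup.map hT.compl b γ → r' γ' = r γ) →
      ∃ hm' : lk' (S'.pres h').meridian = Multiplicative.ofAdd 1,
        (∃ φ' : MulAut H, KnotK1.IsEquivariant r' (S'.pres h').meridian φ') ∧
        ∀ (φ' : MulAut H) (hφ' : KnotK1.IsEquivariant r' (S'.pres h').meridian φ'),
          ∃ hκ' : KnotK1.groupRingAut ℚ φ' ^ N = 1,
          KnotK1.metabelianPolynomial (S.pres h) r hm hφ hκ =
            KnotK1.metabelianPolynomial (S'.pres h') r' hm' hφ' hκ') := by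
  refine ⟨S.isMeridian_iff, ?_, ?_, ?_⟩
  · intro b h h' A _ κ κ' ρ ρ' N _ hκ hρ hρ'
    obtain ⟨γ, hm, hx⟩ := S.pres_conj h h'
    -- The words `yⱼ`, `zⱼ` do not involve the frame, hence the two reflexivity proofs.
    exact KnotK1.containerMap_alexInvariant_eq hm hx rfl rfl hρ hρ' hκ
  · intro b h B _ H _ _ lk r φ hm hφ hr K' T' Ψ hT S' hS h' lk' r' hlk hr'
    obtain ⟨E⟩ := hS.nonempty_presentationIso hT h h' hlk hr'
    exact ⟨E.lk_meridian hm, E.exists_equivariant hφ, fun φ' hφ' =>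
      E.metafinitePolynomial_eq hm _ hφ hφ' hr⟩
  · intro b h N H _ lk r φ hm hφ _ hr
    have hκ := hr.groupRingAut_pow_eq_one ℚ hm hφ
    refine ⟨hκ, fun K' T' Ψ hT S' hS h' lk' r' hlk hr' => ?_⟩
    obtain ⟨E⟩ := hS.nonempty_presentationIso hT h h' hlk hr'
    exact ⟨E.lk_meridian hm, E.exists_equivariant hφ, fun φ' hφ' =>
      ⟨(E.groupRingAut_pow_eq_one_iff hm hφ hφ' hr.surjective N).mp hκ,
        E.metabelianPolynomial_eq hm _ hφ hφ' hr.surjective hκ _⟩⟩
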